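/- Let $n\in\mathbb N$, $0<\alpha<n$, $1<p<\frac n\alpha$, and let $q$ be given by $\frac1p-\frac1q=\frac\alpha n$; write $p'=\frac{p}{p-1}$. For a measurable real-valued function $f$ on $\mathbb R^n$ put $$I_\alpha f(x)=\int_{\mathbb R^n}\frac{f(y)}{|x-y|^{n-\alpha}}\,dy .$$ A weight is a measurable function $w:\mathbb R^n\to[0,\infty]$ that is positive on a set of positive measure and finite on a set of positive measure. For $1<r<\infty$, $f\in L^r(w^r)$ means that $f$ is measurable and $\|f\|_{L^r(w^r)}=\big(\int_{\mathbb R^n}|f|^r w^r\,dx\big)^{1/r}<\infty$. A weight $w$ is in $A_{p,q}$ if $0<w(x)<\infty$ for a.e. $x$ and $$[w]_{A_{p,q}}=\sup_Q\Big(\frac1{|Q|}\int_Q w^q\,dx\Big)^{1/q}\Big(\frac1{|Q|}\int_Q w^{-p'}\,dx\Big)^{1/p'}<\infty,$$ the supremum being over all cubes $Q\subset\mathbb R^n$ with sides parallel to the coordinate axes. Then for every weight $w$ the following are equivalent: 1. $w\in A_{p,q}$; 2. $I_\alpha$ maps $L^p(w^p)$ boundedly into $L^q(w^q)$: there is a constant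 $C<\infty$ such that for every $f\in L^p(w^p)$ the integral $I_\alpha f(x)$ converges absolutely for a.e. $x$, $I_\alpha f\in L^q(w^q)$, and $$\Big(\int_{\mathbb R^n}|I_\alpha f|^q w^q\,dx\Big)^{1/q}\le C\Big(\int_{\mathbb R^n}|f|^p w^p\,dx\Big)^{1/p}.$$ Moreover, if $w\in A_{p,q}$, then the constant $C$ in 2 can be chosen to depend only on $n$, $\alpha$, $p$ and $[w]_{A_{p,q}}$. -/

import Mathlib

open MeasureTheory
open scoped NNReal ENNReal

noncomputable section

/-- The half-open cube with sides parallel to the axes, lower corner `a` and side length `l`. -/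
def cube {n : ℕ} (a : EuclideanSpace ℝ (Fin n)) (l : ℝ) : Set (EuclideanSpace ℝ (Fin n)) :=
  {x | ∀ i, a i ≤ x i ∧ x i < a i + l}

/-- A weight: a (Lebesgue) measurable function with values in `[0, ∞]` that is positive on a set
of positive measure, and finite on a set of positive measure (the latter is automatic for a
`[0, ∞)`-valued function). -/
structure IsWeight {n : ℕ} (w : EuclideanSpace ℝ (Fin n) → ℝ≥0∞) : Prop where
  aemeasurable : AEMeasurable w volume
  pos_on_pos_measure : 0 < volume {x | 0 < w x}
  finite_on_pos_measure : 0 < volume {x | w x < ∞}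

/-- The constant `[w]_{A_{p,q}}`, the supremum over all cubes `Q` of
`(⨍_Q w ^ q) ^ (1 / q) * (⨍_Q w ^ (-p')) ^ (1 / p')`, where `p' = p / (p - 1)`. -/
def apqConst {n : ℕ} (p q : ℝ) (w : EuclideanSpace ℝ (Fin n) → ℝ≥0∞) : ℝ≥0∞ :=
  ⨆ (a : EuclideanSpace ℝ (Fin n)) (l : ℝ) (_ : 0 < l),
    (⨍⁻ x in cube a l, w x ^ q ∂volume) ^ (1 / q) *
      (⨍⁻ x in cube a l, w x ^ (-(p / (p - 1))) ∂volume) ^ (1 / (p / (p - 1)))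

/-- The class `A_{p,q}`. -/
def IsApq {n : ℕ} (p q : ℝ) (w : EuclideanSpace ℝ (Fin n) → ℝ≥0∞) : Prop :=
  (∀ᵐ x ∂volume, 0 < w x ∧ w x < ∞) ∧ apqConst p q w < ∞

/-- The integrand `y ↦ f y / |x - y| ^ (n - α)` of the fractional integral. -/
def fracIntegrand {n : ℕ} (α : ℝ) (f : EuclideanSpace ℝ (Fin n) → ℝ)
    (x y : EuclideanSpace ℝ (Fin n)) : ℝ :=
  f y / ‖x - y‖ ^ ((n : ℝ) - α)

/-- The fractional integral `I_α f`. -/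
def fracIntegral {n : ℕ} (α : ℝ) (f : EuclideanSpace ℝ (Fin n) → ℝ)
    (x : EuclideanSpace ℝ (Fin n)) : ℝ :=
  ∫ y, fracIntegrand α f x y ∂volume

/-- The norm of `f` in `L^r(w^r)`: `(∫ |f| ^ r w ^ r) ^ (1 / r)`, with values in `[0, ∞]`. -/
def weightedNorm {n : ℕ} (r : ℝ) (w : EuclideanSpace ℝ (Fin n) → ℝ≥0∞)
    (f : EuclideanSpace ℝ (Fin n) → ℝ) : ℝ≥0∞ :=
  (∫⁻ x, ‖f x‖ₑ ^ r * w x ^ r ∂volume) ^ (1 / r)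

/-- `f ∈ L^r(w^r)`. -/
def MemWeightedLp {n : ℕ} (r : ℝ) (w : EuclideanSpace ℝ (Fin n) → ℝ≥0∞)
    (f : EuclideanSpace ℝ (Fin n) → ℝ) : Prop :=
  AEStronglyMeasurable f volume ∧ weightedNorm r w f < ∞

/-- `I_α : L^p(w^p) → L^q(w^q)` with bound `C`: for every `f ∈ L^p(w^p)` the integral `I_α f`
converges absolutely almost everywhere, lies in `L^q(w^q)`, and its norm there is at most `C`
times the norm of `f`. -/
def FracIntegralBound {n : ℕ} (α p q : ℝ) (w : EuclideanSpace ℝ (Fin n) → ℝ≥0∞) (C : ℝ≥0) :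
    Prop :=
  ∀ f : EuclideanSpace ℝ (Fin n) → ℝ, MemWeightedLp p w f →
    (∀ᵐ x ∂volume, Integrable (fracIntegrand α f x) volume) ∧
    MemWeightedLp q w (fracIntegral α f) ∧
    weightedNorm q w (fracIntegral α f) ≤ C * weightedNorm p w f

end

/-! Sufficiency. By the one-third trick, two points at distance at most `2 ^ k / 3` lie in a common
cell of generation `k` of one of `2 ^ n` shifted dyadic grids. Hence `I_α |f|` is at most a constant
times the sum, over the grids, of the dyadic operators `∑ 2 ^ (α k) F(Q_k) / |Q_k|`, with `F = |f|
dx` (`lintegral_enorm_fracIntegrand_le`). It remains to bound one such operator from `L^p(w^p)` to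
`L^q(w^q)`.

Put `u = w ^ q`, `σ = w ^ (-p')`, and let `Ω_m` be the set where some average of `F` exceeds
`(2V)^m`, with `V = 2 ^ n` the doubling constant of the grid. Each `Ω_m` is a disjoint union of
maximal cells `P`, and summing over generations leaves only the terms `(2V)^m θ^gen` of these cells
(`fracSum_le`). At most half of `P` lies in `Ω_{m+1}`, by the choice of base. The `A_{p,q}`
condition has an `A_∞` consequence: a subset of at least half the volume carries a fixed proportion
of `u` and of `σ`. So `u (P ∩ Ω_{m+j})` decays geometrically in `j`, which reduces the `q`-th power
of the sum over `m` to a sum of `q`-th powers (`tsum_coef_rpow_le`). For a single cell, `A_{p,q}`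
and Hölder turn the `L^q(u)` term into `(F(P)/σ(P))^p σ(P)` times a power of the norm of `f`
(`zpow_mul_avg_rpow_le`). This is controlled on the disjoint sets `P \ Ω_{m+1}` by the dyadic
maximal function relative to `σ`, which is bounded on `L^p(σ)` with a constant independent of `σ`.

Necessity. On a bounded set `S` the kernel is bounded below, so the inequality tested on functions
supported in `S` bounds `∫ f` times the `L^q(w^q)` norm of `1_S`. Indicators show that `w` is almost
everywhere positive and finite; truncations of `w ^ (-p')` on cubes give the `A_{p,q}` bound. -/

/-! ### Dyadic grids -/

/-- A nested sequence of countable measurable partitions of `X`, indexed by `ℤ`; the partition of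
generation `k` is given by the level sets of `idx k`, and the partitions become coarser as `k`
grows. -/
structure DyadicGrid (X ι : Type*) [MeasurableSpace X] where
  /-- the label of the cell of generation `k` that contains `x` -/
  idx : ℤ → X → ι
  measurableSet_preimage : ∀ k i, MeasurableSet (idx k ⁻¹' {i})
  nested : ∀ k x y, idx k x = idx k y → idx (k + 1) x = idx (k + 1) y

namespace DyadicGrid

variable {X ι : Type*} [MeasurableSpace X] (G : DyadicGrid X ι)

/-- The cell of generation `k` that contains `x`. -/
def cell (k : ℤ) (x : X) : Set X := {y | G.idx k y = G.idx k x}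

lemma measurableSet_cell (k : ℤ) (x : X) : MeasurableSet (G.cell k x) :=
  G.measurableSet_preimage k _

lemma idx_eq_of_le {k l : ℤ} (h : k ≤ l) {x y : X} (hxy : G.idx k x = G.idx k y) :
    G.idx l x = G.idx l y := by
  induction l, h using Int.leInduction with
  | base => exact hxy
  | succ l _ ih => exact G.nested l x y ih

lemma cell_eq_of_mem {k l : ℤ} (h : k ≤ l) {x y : X} (hy : y ∈ G.cell k x) :
    G.cell l y = G.cell l x := by
  have : G.idx l y = G.idx l x := G.idx_eq_of_le h hy
  simp [cell, this]

lemma cell_subset {k l : ℤ} (h : k ≤ l) (x : X) : G.cell k x ⊆ G.cell l x :=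
  fun _ hy => G.idx_eq_of_le h hy

lemma measurable_comp_cell [Countable ι] {β : Type*} [MeasurableSpace β] (k : ℤ) (F : Set X → β) :
    Measurable fun x => F (G.cell k x) := by
  let _ : MeasurableSpace ι := ⊤
  have h1 : Measurable (G.idx k) := measurable_to_countable' (G.measurableSet_preimage k)
  exact (measurable_from_top (f := fun i => F (G.idx k ⁻¹' {i}))).comp h1

/-- A set that is a union of cells, the cell of `x` having generation `τ x`. -/
def IsStopping (Ω : Set X) (τ : X → ℤ) : Prop :=
  ∀ x ∈ Ω, ∀ y ∈ G.cell (τ x) x, y ∈ Ω ∧ τ y = τ x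

variable {G} in
-- Any two of the selected cells coincide or are disjoint, and there are countably many labels, so
-- an inequality known on each cell can be summed.
lemma IsStopping.measure_le [Countable ι] {Ω : Set X} {τ : X → ℤ} (h : G.IsStopping Ω τ)
    {μ ν : Measure X} (hμ : ∀ x ∈ Ω, μ (G.cell (τ x) x) ≤ ν (G.cell (τ x) x)) : μ Ω ≤ ν Ω := by
  set S : Set (ℤ × ι) := (fun x => (τ x, G.idx (τ x) x)) '' Ω with hS
  have hU : Ω = ⋃ s ∈ S, G.idx s.1 ⁻¹' {s.2} := by
    ext y
    simp only [Set.mem_iUnion, exists_prop, Set.mem_preimage, Set.mem_singleton_iff]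
    constructor
    · intro hy
      exact ⟨(τ y, G.idx (τ y) y), ⟨y, hy, rfl⟩, rfl⟩
    · rintro ⟨_, ⟨x, hx, rfl⟩, hy⟩
      exact (h x hx y hy).1
  have hd : S.PairwiseDisjoint fun s => G.idx s.1 ⁻¹' {s.2} := by
    rintro _ ⟨x, hx, rfl⟩ _ ⟨y, hy, rfl⟩ hne
    refine Set.disjoint_left.2 fun z hz hz' => hne ?_
    have h1 := (h x hx z hz).2
    have h2 := (h y hy z hz').2
    simp only [Set.mem_preimage, Set.mem_singleton_iff] at hz hz' ⊢
    have h3 : τ x = τ y := h1.symm.trans h2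
    rw [h3] at hz
    rw [h3, ← hz, ← hz']
  have hm : ∀ s ∈ S, MeasurableSet (G.idx s.1 ⁻¹' {s.2}) := fun s _ =>
    G.measurableSet_preimage _ _
  rw [hU, measure_biUnion S.to_countable hd hm, measure_biUnion S.to_countable hd hm]
  refine ENNReal.tsum_le_tsum ?_
  rintro ⟨_, x, hx, rfl⟩
  exact hμ x hx

/-- The dyadic maximal function of the measure `F` with respect to `σ`. -/
noncomputable def maxAvg (F σ : Measure X) (x : X) : ℝ≥0∞ := ⨆ k, F (G.cell k x) / σ (G.cell k x)

lemma measurable_maxAvg [Countable ι] (F σ : Measure X) : Measurable (G.maxAvg F σ) :=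
  Measurable.iSup fun k => G.measurable_comp_cell k fun Q => F Q / σ Q

/-- The weak type inequality, with constant one: the level set splits into maximal cells on which
the average exceeds `t`. -/
lemma mul_measure_lt_maxAvg_le [Countable ι] (F σ : Measure X)
    (hσ₀ : ∀ k x, σ (G.cell k x) ≠ 0) (hσ : ∀ k x, σ (G.cell k x) ≠ ∞) (t : ℝ≥0∞) :
    t * σ {x | t < G.maxAvg F σ x} ≤ F {x | t < G.maxAvg F σ x} := by
  -- A maximal cell need not exist among all generations; generations are capped at `N`, and `N → ∞`
  -- at the end.
  set Ω : ℕ → Set X := fun N => {x | ∃ k : ℤ, k ≤ N ∧ t < F (G.cell k x) / σ (G.cell k x)} with hΩ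
  have hU : {x | t < G.maxAvg F σ x} = ⋃ N, Ω N := by
    ext x
    simp only [maxAvg, lt_iSup_iff, Set.mem_ofPred_eq, hΩ, Set.mem_iUnion]
    constructor
    · rintro ⟨k, hk⟩
      exact ⟨k.toNat, k, Int.self_le_toNat k, hk⟩
    · rintro ⟨N, k, -, hk⟩
      exact ⟨k, hk⟩
  have hmono : Monotone Ω := by
    intro N M hNM x ⟨k, hk, hx⟩
    exact ⟨k, hk.trans (by exact_mod_cast hNM), hx⟩
  have key : ∀ N, t * σ (Ω N) ≤ F (Ω N) := by
    intro N
    have hg : ∀ x, x ∈ Ω N → ∃ m : ℤ, (m ≤ N ∧ t < F (G.cell m x) / σ (G.cell m x)) ∧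
        ∀ k : ℤ, (k ≤ N ∧ t < F (G.cell k x) / σ (G.cell k x)) → k ≤ m := fun x hx =>
      Int.exists_greatest_of_bdd ⟨N, fun k hk => hk.1⟩ hx
    choose! τ hτ hτ' using hg
    have hτΩ : G.IsStopping (Ω N) τ := by
      intro x hx y hy
      have hc : ∀ l, τ x ≤ l → G.cell l y = G.cell l x := fun l hl => G.cell_eq_of_mem hl hy
      have hyΩ : y ∈ Ω N := ⟨τ x, (hτ x hx).1, by rw [hc _ le_rfl]; exact (hτ x hx).2⟩
      refine ⟨hyΩ, le_antisymm ?_ ?_⟩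
      · by_contra! hlt
        have := hτ' x hx (τ y) ⟨(hτ y hyΩ).1, by rw [← hc _ hlt.le]; exact (hτ y hyΩ).2⟩
        omega
      · exact hτ' y hyΩ _ ⟨(hτ x hx).1, by rw [hc _ le_rfl]; exact (hτ x hx).2⟩
    have := hτΩ.measure_le (μ := t • σ) (ν := F) fun x hx => by
      have h1 := (hτ x hx).2.le
      rw [ENNReal.le_div_iff_mul_le (.inl (hσ₀ _ _)) (.inl (hσ _ _))] at h1
      simpa using h1
    simpa using this
  rw [hU, hmono.measure_iUnion, ENNReal.mul_iSup]
  exact iSup_le fun N => (key N).trans (measure_mono (Set.subset_iUnion Ω N))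

end DyadicGrid

/-! ### Geometric sums -/

lemma tsum_zpow_of_le {θ : ℝ≥0∞} (h1 : 1 < θ) (h2 : θ ≠ ∞) (m : ℤ) :
    ∑' k : ℤ, (if k ≤ m then θ ^ k else 0) = θ ^ m * (1 - θ⁻¹)⁻¹ := by
  have h0 : θ ≠ 0 := (zero_lt_one.trans h1).ne'
  have hinj : Function.Injective fun i : ℕ => m - (i : ℤ) := fun i j h => by
    simp only at h; omega
  rw [← hinj.tsum_eq, ← ENNReal.tsum_geometric, ← ENNReal.tsum_mul_left]
  · refine tsum_congr fun i => ?_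
    rw [if_pos (by omega), ENNReal.zpow_sub h0 h2]
    simp [ENNReal.inv_pow]
  · intro k hk
    simp only [Function.mem_support, ne_eq, ite_eq_right_iff, not_forall] at hk
    exact ⟨(m - k).toNat, by simp only; have := hk.1; omega⟩

lemma one_sub_inv_inv_ne_top {θ : ℝ≥0∞} (h1 : 1 < θ) : (1 - θ⁻¹)⁻¹ ≠ ∞ := by
  have : θ⁻¹ < 1 := ENNReal.inv_lt_one.2 h1
  exact ENNReal.inv_ne_top.2 (tsub_pos_of_lt this).ne'

lemma ENNReal.rpow_zpow_comm (x : ℝ≥0∞) (s : ℝ) (k : ℤ) : (x ^ k) ^ s = (x ^ s) ^ k := by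
  rw [← ENNReal.rpow_intCast, ← ENNReal.rpow_intCast, ← ENNReal.rpow_mul, ← ENNReal.rpow_mul,
    mul_comm]

lemma ENNReal.one_lt_two_rpow {s : ℝ} (hs : 0 < s) : 1 < (2 : ℝ≥0∞) ^ s :=
  ENNReal.one_lt_rpow one_lt_two hs

lemma ENNReal.two_rpow_ne_top {s : ℝ} (hs : 0 < s) : (2 : ℝ≥0∞) ^ s ≠ ∞ :=
  ENNReal.rpow_ne_top_of_nonneg hs.le (by simp)

/-- `∑ (2 ^ k) ^ s` over all `k` with `2 ^ k < z` is bounded by a multiple of `z ^ s`. -/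
lemma tsum_two_zpow_rpow_le {s : ℝ} (hs : 0 < s) (z : ℝ≥0∞) :
    ∑' k : ℤ, (if (2 : ℝ≥0∞) ^ k < z then ((2 : ℝ≥0∞) ^ k) ^ s else 0) ≤
      z ^ s * (1 - ((2 : ℝ≥0∞) ^ s)⁻¹)⁻¹ := by
  rcases eq_or_ne z 0 with rfl | hz
  · simp
  rcases eq_or_ne z ∞ with rfl | hz'
  · rw [ENNReal.top_rpow_of_pos hs, ENNReal.top_mul]
    · exact le_top
    · simp
  obtain ⟨m, hm, hm'⟩ := ENNReal.exists_mem_Ioc_zpow hz hz' ENNReal.one_lt_two (by simp)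
  calc ∑' k : ℤ, (if (2 : ℝ≥0∞) ^ k < z then ((2 : ℝ≥0∞) ^ k) ^ s else 0)
      ≤ ∑' k : ℤ, (if k ≤ m then ((2 : ℝ≥0∞) ^ s) ^ k else 0) := by
        refine ENNReal.tsum_le_tsum fun k => ?_
        split_ifs with h1 h2
        · rw [ENNReal.rpow_zpow_comm]
        · exact absurd (h1.trans_le hm') (not_lt.2 (ENNReal.zpow_le_of_le one_le_two (by omega)))
        · exact zero_le
        · exact le_rfl
    _ = ((2 : ℝ≥0∞) ^ m) ^ s * (1 - ((2 : ℝ≥0∞) ^ s)⁻¹)⁻¹ := by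
        rw [tsum_zpow_of_le (ENNReal.one_lt_two_rpow hs) (ENNReal.two_rpow_ne_top hs),
          ENNReal.rpow_zpow_comm]
    _ ≤ _ := by gcongr

/-- A discrete layer-cake bound: for finite `y > 0` the one term with `2 * 2 ^ k < y ≤ 4 * 2 ^ k`
suffices. The threshold `2 * 2 ^ k` matches the localized weak type inequality. -/
lemma rpow_le_tsum_two_zpow {p : ℝ} (hp : 0 < p) (y : ℝ≥0∞) :
    y ^ p ≤ ∑' k : ℤ, (if 2 * (2 : ℝ≥0∞) ^ k < y then (4 * (2 : ℝ≥0∞) ^ k) ^ p else 0) := by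
  have h20 : (2 : ℝ≥0∞) ≠ 0 := by simp
  have h2t : (2 : ℝ≥0∞) ≠ ∞ := by simp
  rcases eq_or_ne y 0 with rfl | hy
  · simp [hp]
  rcases eq_or_ne y ∞ with rfl | hy'
  · have hlt : ∀ k : ℤ, 2 * (2 : ℝ≥0∞) ^ k < ∞ := fun k =>
      ENNReal.mul_lt_top (by simp) (ENNReal.zpow_lt_top h20 h2t k)
    simp only [hlt, if_true]
    refine (ENNReal.tsum_const_eq_top_of_ne_zero (α := ℕ) (c := 1) one_ne_zero).symm.le.trans'
      le_top |>.trans ?_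
    calc ∑' _ : ℕ, (1 : ℝ≥0∞) ≤ ∑' i : ℕ, (4 * (2 : ℝ≥0∞) ^ (i : ℤ)) ^ p := by
          refine ENNReal.tsum_le_tsum fun i => ?_
          refine ENNReal.one_le_rpow ?_ hp
          rw [zpow_natCast]
          exact one_le_mul (by norm_num) (one_le_pow₀ one_le_two)
      _ ≤ _ := ENNReal.tsum_comp_le_tsum_of_injective (f := fun i : ℕ => (i : ℤ))
          Nat.cast_injective fun k : ℤ => (4 * (2 : ℝ≥0∞) ^ k) ^ p
  obtain ⟨m, hm, hm'⟩ := ENNReal.exists_mem_Ioc_zpow hy hy' ENNReal.one_lt_two (by simp)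
  have e1 : 2 * (2 : ℝ≥0∞) ^ (m - 1) = 2 ^ m := by
    conv_rhs => rw [show m = 1 + (m - 1) by ring, ENNReal.zpow_add h20 h2t, zpow_one]
  have e2 : 4 * (2 : ℝ≥0∞) ^ (m - 1) = 2 ^ (m + 1) := by
    rw [ENNReal.zpow_add h20 h2t, ← e1, zpow_one, mul_comm 2, mul_assoc, mul_comm]; norm_num
  refine le_trans ?_ (ENNReal.le_tsum (m - 1))
  rw [e1, e2, if_pos hm]
  gcongr

/-- The constant in the dyadic maximal theorem. -/
noncomputable def maximalConst (p : ℝ) : ℝ≥0∞ := 4 ^ p * (1 - ((2 : ℝ≥0∞) ^ (p - 1))⁻¹)⁻¹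

lemma maximalConst_ne_top {p : ℝ} (hp : 1 < p) : maximalConst p ≠ ∞ :=
  ENNReal.mul_ne_top (ENNReal.rpow_ne_top_of_nonneg (by linarith) (by simp))
    (one_sub_inv_inv_ne_top (ENNReal.one_lt_two_rpow (by linarith)))

/-! ### The dyadic maximal theorem. -/

namespace DyadicGrid

variable {X ι : Type*} [MeasurableSpace X] (G : DyadicGrid X ι)

/-- The weak type inequality, localized to the set where the function is large. -/
lemma mul_measure_two_mul_lt_maxAvg_le [Countable ι] (σ : Measure X)
    (hσ₀ : ∀ k x, σ (G.cell k x) ≠ 0) (hσ : ∀ k x, σ (G.cell k x) ≠ ∞) {φ : X → ℝ≥0∞}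
    (hφ : Measurable φ) {t : ℝ≥0∞} (ht : t ≠ ∞) :
    t * σ {x | 2 * t < G.maxAvg (σ.withDensity φ) σ x} ≤ ∫⁻ x in {x | t < φ x}, φ x ∂σ := by
  set S : Set X := {x | t < φ x}
  have hS : MeasurableSet S := measurableSet_lt measurable_const hφ
  set F := σ.withDensity (S.indicator φ) with hF
  -- The part of `φ` below `t` contributes at most `t` to any average.
  have hsub : {x | 2 * t < G.maxAvg (σ.withDensity φ) σ x} ⊆ {x | t < G.maxAvg F σ x} := by
    intro x hx
    simp only [maxAvg, lt_iSup_iff, Set.mem_ofPred_eq] at hx ⊢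
    obtain ⟨k, hk⟩ := hx
    refine ⟨k, ?_⟩
    have h1 : σ.withDensity φ (G.cell k x) ≤ t * σ (G.cell k x) + F (G.cell k x) := by
      have hc := G.measurableSet_cell k x
      rw [hF, withDensity_apply _ hc, withDensity_apply _ hc, ← setLIntegral_const,
        ← lintegral_add_left measurable_const]
      refine lintegral_mono fun y => ?_
      by_cases hy : y ∈ S
      · simp [hy]
      · simp only [hy, not_false_eq_true, Set.indicator_of_notMem, add_zero]
        exact not_lt.1 hy
    have h2 : σ.withDensity φ (G.cell k x) / σ (G.cell k x) ≤
        t + F (G.cell k x) / σ (G.cell k x) := by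
      calc _ ≤ (t * σ (G.cell k x) + F (G.cell k x)) / σ (G.cell k x) := by gcongr
        _ = _ := by rw [ENNReal.add_div, ENNReal.mul_div_cancel_right (hσ₀ _ _) (hσ _ _)]
    rw [two_mul] at hk
    exact (ENNReal.add_lt_add_iff_left ht).1 (hk.trans_le h2)
  calc t * σ {x | 2 * t < G.maxAvg (σ.withDensity φ) σ x}
      ≤ t * σ {x | t < G.maxAvg F σ x} := by gcongr
    _ ≤ F {x | t < G.maxAvg F σ x} := G.mul_measure_lt_maxAvg_le F σ hσ₀ hσ t
    _ ≤ F Set.univ := measure_mono (Set.subset_univ _)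
    _ = _ := by
        rw [hF, withDensity_apply _ .univ, setLIntegral_univ, lintegral_indicator hS]

/-- The dyadic maximal theorem on `L ^ p`. -/
lemma lintegral_maxAvg_rpow_le [Countable ι] (σ : Measure X)
    (hσ₀ : ∀ k x, σ (G.cell k x) ≠ 0) (hσ : ∀ k x, σ (G.cell k x) ≠ ∞) {φ : X → ℝ≥0∞}
    (hφ : Measurable φ) {p : ℝ} (hp : 1 < p) :
    ∫⁻ x, G.maxAvg (σ.withDensity φ) σ x ^ p ∂σ ≤ maximalConst p * ∫⁻ x, φ x ^ p ∂σ := by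
  have h20 : (2 : ℝ≥0∞) ≠ 0 := by simp
  have h2t : (2 : ℝ≥0∞) ≠ ∞ := by simp
  set M := G.maxAvg (σ.withDensity φ) σ with hM
  have hMm : Measurable M := G.measurable_maxAvg _ _
  calc ∫⁻ x, M x ^ p ∂σ
      ≤ ∫⁻ x, ∑' k : ℤ, {x | 2 * (2 : ℝ≥0∞) ^ k < M x}.indicator
          (fun _ => (4 * (2 : ℝ≥0∞) ^ k) ^ p) x ∂σ := by
        refine lintegral_mono fun x => (rpow_le_tsum_two_zpow (by linarith) _).trans_eq ?_
        simp [Set.indicator_apply]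
    _ = ∑' k : ℤ, (4 * (2 : ℝ≥0∞) ^ k) ^ p * σ {x | 2 * (2 : ℝ≥0∞) ^ k < M x} := by
        rw [lintegral_tsum fun k => (measurable_const.indicator
          (measurableSet_lt measurable_const hMm)).aemeasurable]
        refine tsum_congr fun k => ?_
        rw [lintegral_indicator_const (measurableSet_lt measurable_const hMm)]
    -- One factor `2 ^ k` is spent on the weak type inequality; the remaining power `p - 1 > 0`
    -- makes the sum over `2 ^ k < φ x` geometric.
    _ ≤ ∑' k : ℤ, 4 ^ p * ((2 : ℝ≥0∞) ^ k) ^ (p - 1) *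
          ∫⁻ x in {x | (2 : ℝ≥0∞) ^ k < φ x}, φ x ∂σ := by
        refine ENNReal.tsum_le_tsum fun k => ?_
        have hk0 := (ENNReal.zpow_pos h20 h2t k).ne'
        have hkt := (ENNReal.zpow_lt_top h20 h2t k).ne
        calc (4 * (2 : ℝ≥0∞) ^ k) ^ p * σ {x | 2 * (2 : ℝ≥0∞) ^ k < M x}
            = 4 ^ p * ((2 : ℝ≥0∞) ^ k) ^ (p - 1) *
              ((2 : ℝ≥0∞) ^ k * σ {x | 2 * (2 : ℝ≥0∞) ^ k < M x}) := by
              rw [ENNReal.mul_rpow_of_nonneg _ _ (by linarith),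
                show p = (p - 1) + 1 by ring, ENNReal.rpow_add _ _ hk0 hkt, ENNReal.rpow_one]
              ring_nf
          _ ≤ _ := by
              gcongr
              exact G.mul_measure_two_mul_lt_maxAvg_le σ hσ₀ hσ hφ hkt
    _ = ∫⁻ x, 4 ^ p * (φ x * ∑' k : ℤ, if (2 : ℝ≥0∞) ^ k < φ x then
          ((2 : ℝ≥0∞) ^ k) ^ (p - 1) else 0) ∂σ := by
        simp_rw [← ENNReal.tsum_mul_left]
        rw [lintegral_tsum]
        · refine tsum_congr fun k => ?_
          rw [← lintegral_indicator (measurableSet_lt measurable_const hφ), ← lintegral_const_mul]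
          · refine lintegral_congr fun x => ?_
            simp only [Set.indicator_apply, Set.mem_ofPred_eq]
            split_ifs
            · ring
            · simp
          · exact hφ.indicator (measurableSet_lt measurable_const hφ)
        · intro k
          refine (Measurable.const_mul (hφ.mul ?_) _).aemeasurable
          exact Measurable.ite (measurableSet_lt measurable_const hφ) measurable_const
            measurable_const
    _ ≤ ∫⁻ x, maximalConst p * φ x ^ p ∂σ := by
        refine lintegral_mono fun x => ?_
        calc _ ≤ 4 ^ p * (φ x * (φ x ^ (p - 1) * (1 - ((2 : ℝ≥0∞) ^ (p - 1))⁻¹)⁻¹)) := by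
              gcongr; exact tsum_two_zpow_rpow_le (by linarith) _
          _ = 4 ^ p * (1 - ((2 : ℝ≥0∞) ^ (p - 1))⁻¹)⁻¹ * (φ x ^ (1 : ℝ) * φ x ^ (p - 1)) := by
              rw [ENNReal.rpow_one]; ring
          _ = _ := by
              rw [← ENNReal.rpow_add_of_nonneg _ _ zero_le_one (by linarith), maximalConst]
              congr 2; ring
    _ = _ := lintegral_const_mul _ (hφ.pow_const p)

end DyadicGrid

/-! ### Dyadic fractional integrals -/

namespace DyadicGrid

variable {X ι : Type*} [MeasurableSpace X]

/-- The hypotheses on the measures `v` (Lebesgue measure), `u` (`w ^ q`), `σ` (`w ^ (-p')`) and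
`F` (the function to which the operator is applied) under which the dyadic fractional integral
`∑ θ ^ k F(Q_k) / v(Q_k)` is bounded. -/
structure Admissible (G : DyadicGrid X ι) (v u σ F : Measure X) (θ V D K N : ℝ≥0∞) (p q : ℝ) :
    Prop where
  v_ne_zero : ∀ k x, v (G.cell k x) ≠ 0
  v_ne_top : ∀ k x, v (G.cell k x) ≠ ∞
  u_ne_zero : ∀ k x, u (G.cell k x) ≠ 0
  u_ne_top : ∀ k x, u (G.cell k x) ≠ ∞
  σ_ne_zero : ∀ k x, σ (G.cell k x) ≠ 0
  σ_ne_top : ∀ k x, σ (G.cell k x) ≠ ∞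
  one_lt_θ : 1 < θ
  θ_ne_top : θ ≠ ∞
  one_le_V : 1 ≤ V
  V_ne_top : V ≠ ∞
  D_ne_top : D ≠ ∞
  K_ne_top : K ≠ ∞
  N_ne_top : N ≠ ∞
  one_lt_p : 1 < p
  p_lt_q : p < q
  doubling : ∀ k x, v (G.cell (k + 1) x) ≤ V * v (G.cell k x)
  -- The `A_{p,q}` condition with constant `K`: for `θ = 2 ^ α` the factor `θ ^ k` is `|Q| ^ (α /
  -- n)`, which brings the power of `|Q|` to one. In `holder`, `N` stands for the norm of `f`; `D`
  -- is the `A_∞` constant of `u` and `σ`.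
  char_le : ∀ k x, θ ^ k * (u (G.cell k x) ^ (1 / q) * σ (G.cell k x) ^ (1 - 1 / p)) ≤
    K * v (G.cell k x)
  holder : ∀ k x, F (G.cell k x) ≤ σ (G.cell k x) ^ (1 - 1 / p) * N
  u_le : ∀ k x E, MeasurableSet E → E ⊆ G.cell k x → v (G.cell k x) ≤ 2 * v E →
    u (G.cell k x) ≤ D * u E
  σ_le : ∀ k x E, MeasurableSet E → E ⊆ G.cell k x → v (G.cell k x) ≤ 2 * v E →
    σ (G.cell k x) ≤ D * σ E

variable (G : DyadicGrid X ι)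

/-- The dyadic fractional integral of the measure `F`. -/
noncomputable def fracSum (v F : Measure X) (θ : ℝ≥0∞) (x : X) : ℝ≥0∞ :=
  ∑' k : ℤ, θ ^ k * (F (G.cell k x) / v (G.cell k x))

/-- The set where some average of `F` exceeds `(2 * V) ^ m`. -/
def level (v F : Measure X) (V : ℝ≥0∞) (m : ℤ) : Set X :=
  {x | ∃ k, (2 * V) ^ m < F (G.cell k x) / v (G.cell k x)}

/-- The largest generation of a cell around `x` with average above `(2 * V) ^ m`. -/
noncomputable def gen (v F : Measure X) (V : ℝ≥0∞) (m : ℤ) (x : X) : ℤ :=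
  sSup {k | (2 * V) ^ m < F (G.cell k x) / v (G.cell k x)}

/-- The contribution to the fractional integral of the cell of generation `gen m x`. -/
noncomputable def coef (v F : Measure X) (θ V : ℝ≥0∞) (m : ℤ) (x : X) : ℝ≥0∞ :=
  ⨆ k, if (2 * V) ^ m < F (G.cell k x) / v (G.cell k x) then (2 * V) ^ m * θ ^ k else 0

/-- As a supremum of functions constant on cells, the coefficient is measurable without any
discussion of `gen`. -/
lemma measurable_coef [Countable ι] (v F : Measure X) (θ V : ℝ≥0∞) (m : ℤ) :
    Measurable (G.coef v F θ V m) := by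
  classical
  exact Measurable.iSup fun k => G.measurable_comp_cell k fun Q =>
    if (2 * V) ^ m < F Q / v Q then (2 * V) ^ m * θ ^ k else 0

lemma measurableSet_level [Countable ι] (v F : Measure X) (V : ℝ≥0∞) (m : ℤ) :
    MeasurableSet (G.level v F V m) := by
  have : G.level v F V m = ⋃ k : ℤ, {x | (2 * V) ^ m < F (G.cell k x) / v (G.cell k x)} := by
    ext; simp [level]
  rw [this]
  exact MeasurableSet.iUnion fun k =>
    measurableSet_lt measurable_const (G.measurable_comp_cell k fun Q => F Q / v Q)

lemma measurable_fracSum [Countable ι] (v F : Measure X) (θ : ℝ≥0∞) :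
    Measurable (G.fracSum v F θ) :=
  Measurable.tsum fun k => (G.measurable_comp_cell k fun Q => θ ^ k * (F Q / v Q))

namespace Admissible

variable {G} {v u σ F : Measure X} {θ V D K N : ℝ≥0∞} {p q : ℝ}

lemma one_lt_two_mul (h : G.Admissible v u σ F θ V D K N p q) : 1 < 2 * V :=
  ENNReal.one_lt_two.trans_le (by simpa using mul_le_mul_right h.one_le_V 2)

lemma two_mul_ne_top (h : G.Admissible v u σ F θ V D K N p q) : 2 * V ≠ ∞ :=
  ENNReal.mul_ne_top (by simp) h.V_ne_top

lemma two_mul_zpow_ne_zero (h : G.Admissible v u σ F θ V D K N p q) (m : ℤ) :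
    (2 * V) ^ m ≠ 0 :=
  (ENNReal.zpow_pos (zero_lt_one.trans h.one_lt_two_mul).ne' h.two_mul_ne_top m).ne'

lemma two_mul_zpow_ne_top (h : G.Admissible v u σ F θ V D K N p q) (m : ℤ) :
    (2 * V) ^ m ≠ ∞ :=
  ENNReal.zpow_ne_top (zero_lt_one.trans h.one_lt_two_mul).ne' h.two_mul_ne_top m

lemma θ_ne_zero (h : G.Admissible v u σ F θ V D K N p q) : θ ≠ 0 :=
  (zero_lt_one.trans h.one_lt_θ).ne'

lemma q_pos (h : G.Admissible v u σ F θ V D K N p q) : 0 < q := by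
  linarith [h.one_lt_p, h.p_lt_q]

lemma one_sub_nonneg (h : G.Admissible v u σ F θ V D K N p q) : 0 ≤ 1 - 1 / p := by
  have := h.one_lt_p
  rw [sub_nonneg, div_le_one (by linarith)]; exact this.le

lemma F_ne_top (h : G.Admissible v u σ F θ V D K N p q) (k : ℤ) (x : X) :
    F (G.cell k x) ≠ ∞ :=
  ne_top_of_le_ne_top (ENNReal.mul_ne_top
    (ENNReal.rpow_ne_top_of_nonneg h.one_sub_nonneg (h.σ_ne_top k x)) h.N_ne_top) (h.holder k x)

/-- Hölder bounds `F` by a power of `σ`, and `char_le` absorbs that power. -/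
lemma zpow_mul_avg_mul_le (h : G.Admissible v u σ F θ V D K N p q) (k : ℤ) (x : X) :
    θ ^ k * (F (G.cell k x) / v (G.cell k x)) * u (G.cell k x) ^ (1 / q) ≤ K * N := by
  set Q := G.cell k x
  calc θ ^ k * (F Q / v Q) * u Q ^ (1 / q)
      ≤ θ ^ k * ((σ Q ^ (1 - 1 / p) * N) / v Q) * u Q ^ (1 / q) := by
        gcongr; exact h.holder k x
    _ = (θ ^ k * (u Q ^ (1 / q) * σ Q ^ (1 - 1 / p))) * (v Q)⁻¹ * N := by
        rw [div_eq_mul_inv]; ring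
    _ ≤ (K * v Q) * (v Q)⁻¹ * N := by
        gcongr ?_ * _ * _
        exact h.char_le k x
    _ = K * N := by rw [mul_assoc K, ENNReal.mul_inv_cancel (h.v_ne_zero k x) (h.v_ne_top k x),
        mul_one]

/-- This makes maximal cells exist: a large average in generation `k ≥ 0` forces `θ ^ k` times a
positive constant, built from `u` of the cell of generation `0`, below `K * N`, which fails for
large `k`. -/
lemma bddAbove (h : G.Admissible v u σ F θ V D K N p q) (m : ℤ) (x : X) :
    BddAbove {k | (2 * V) ^ m < F (G.cell k x) / v (G.cell k x)} := by
  set c := (2 * V) ^ m * u (G.cell 0 x) ^ (1 / q) with hc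
  have hc0 : c ≠ 0 := mul_ne_zero (h.two_mul_zpow_ne_zero m)
    (ENNReal.rpow_pos (h.u_ne_zero 0 x).bot_lt (h.u_ne_top 0 x)).ne'
  have hlt : K * N / c < ∞ := ENNReal.div_lt_top (ENNReal.mul_ne_top h.K_ne_top h.N_ne_top) hc0
  obtain ⟨n, hn⟩ : ∃ n : ℕ, K * N / c < θ ^ n :=
    ((ENNReal.tendsto_pow_atTop_nhds_top_iff.2 h.one_lt_θ).eventually (lt_mem_nhds hlt)).exists
  refine ⟨n, fun k hk => ?_⟩
  by_contra! hkn
  have h1 : θ ^ k * c ≤ K * N := by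
    refine le_trans ?_ (h.zpow_mul_avg_mul_le k x)
    rw [hc, ← mul_assoc]
    have : G.cell 0 x ⊆ G.cell k x := G.cell_subset (by omega) x
    have hq := h.q_pos
    gcongr
    exact hk.le
  have h2 : θ ^ k ≤ K * N / c := by
    rw [ENNReal.le_div_iff_mul_le (.inl hc0)
      (.inr (ENNReal.mul_ne_top h.K_ne_top h.N_ne_top))]
    exact h1
  have h3 : θ ^ (n : ℤ) ≤ θ ^ k := ENNReal.zpow_le_of_le h.one_lt_θ.le hkn.le
  rw [zpow_natCast] at h3
  exact absurd hn (not_lt.2 (h3.trans h2))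

lemma lt_avg_gen (h : G.Admissible v u σ F θ V D K N p q) {m : ℤ} {x : X}
    (hx : x ∈ G.level v F V m) :
    (2 * V) ^ m < F (G.cell (G.gen v F V m x) x) / v (G.cell (G.gen v F V m x) x) :=
  Int.csSup_mem (s := {k | (2 * V) ^ m < F (G.cell k x) / v (G.cell k x)}) hx (h.bddAbove m x)

lemma le_gen (h : G.Admissible v u σ F θ V D K N p q) {m k : ℤ} {x : X}
    (hk : (2 * V) ^ m < F (G.cell k x) / v (G.cell k x)) : k ≤ G.gen v F V m x :=
  le_csSup (h.bddAbove m x) hk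

lemma level_anti (h : G.Admissible v u σ F θ V D K N p q) : Antitone (G.level v F V) :=
  fun _ _ hmm _ ⟨k, hk⟩ => ⟨k, (ENNReal.zpow_le_of_le h.one_lt_two_mul.le hmm).trans_lt hk⟩

lemma gen_anti (h : G.Admissible v u σ F θ V D K N p q) {m m' : ℤ} (hmm : m ≤ m') {x : X}
    (hx : x ∈ G.level v F V m') : G.gen v F V m' x ≤ G.gen v F V m x :=
  h.le_gen ((ENNReal.zpow_le_of_le h.one_lt_two_mul.le hmm).trans_lt (h.lt_avg_gen hx))

lemma isStopping_level (h : G.Admissible v u σ F θ V D K N p q) (m : ℤ) :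
    G.IsStopping (G.level v F V m) (G.gen v F V m) := by
  intro x hx y hy
  have hc : ∀ l, G.gen v F V m x ≤ l → G.cell l y = G.cell l x := fun l hl =>
    G.cell_eq_of_mem hl hy
  have hyΩ' : (2 * V) ^ m < F (G.cell (G.gen v F V m x) y) / v (G.cell (G.gen v F V m x) y) := by
    rw [hc _ le_rfl]; exact h.lt_avg_gen hx
  have hyΩ : y ∈ G.level v F V m := ⟨_, hyΩ'⟩
  have h1 := h.le_gen hyΩ'
  refine ⟨hyΩ, le_antisymm (h.le_gen ?_) h1⟩
  rw [← hc _ h1]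
  exact h.lt_avg_gen hyΩ

/-- Raising the threshold shrinks maximal cells, so those of level `m'` that meet a maximal cell of
level `m` lie inside it. -/
lemma isStopping_cell_inter (h : G.Admissible v u σ F θ V D K N p q) {m m' : ℤ} (hmm : m ≤ m')
    {x : X} (hx : x ∈ G.level v F V m) :
    G.IsStopping (G.cell (G.gen v F V m x) x ∩ G.level v F V m') (G.gen v F V m') := by
  rintro y ⟨hy, hy'⟩ z hz
  have h1 := h.isStopping_level m' y hy' z hz
  refine ⟨⟨?_, h1.1⟩, h1.2⟩
  have h2 := h.gen_anti hmm hy'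
  rw [(h.isStopping_level m x hx y hy).2] at h2
  rw [← G.cell_eq_of_mem le_rfl hy]
  exact G.cell_subset h2 y hz

/-- Sparseness, and the reason for the base `2 * V`. By maximality the parent of `P` has average at
most `(2V)^m`, so `F P ≤ (2V)^m * V * v P`, while `F` has average above `(2V)^(m+1)` on the cells
making up `P ∩ Ω_{m+1}`. -/
lemma v_cell_gen_inter_le (h : G.Admissible v u σ F θ V D K N p q) [Countable ι] {m : ℤ} {x : X}
    (hx : x ∈ G.level v F V m) :
    2 * v (G.cell (G.gen v F V m x) x ∩ G.level v F V (m + 1)) ≤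
      v (G.cell (G.gen v F V m x) x) := by
  set k := G.gen v F V m x with hk
  set P := G.cell k x with hP
  have h1 : (2 * V) ^ (m + 1) * v (P ∩ G.level v F V (m + 1)) ≤
      F (P ∩ G.level v F V (m + 1)) := by
    have := (h.isStopping_cell_inter (show m ≤ m + 1 by omega) hx).measure_le
      (μ := (2 * V) ^ (m + 1) • v) (ν := F) fun y hy => by
        have h1 := (h.lt_avg_gen hy.2).le
        rw [ENNReal.le_div_iff_mul_le (.inl (h.v_ne_zero _ _)) (.inl (h.v_ne_top _ _))] at h1
        simpa using h1
    simpa using this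
  have h2 : F (G.cell (k + 1) x) ≤ (2 * V) ^ m * v (G.cell (k + 1) x) := by
    have : ¬ (2 * V) ^ m < F (G.cell (k + 1) x) / v (G.cell (k + 1) x) := fun hlt => by
      have := h.le_gen hlt
      omega
    rwa [not_lt, ENNReal.div_le_iff (h.v_ne_zero _ _) (h.v_ne_top _ _)] at this
  have h3 : (2 * V) ^ m * V * (2 * v (P ∩ G.level v F V (m + 1))) ≤ (2 * V) ^ m * V * v P := by
    calc (2 * V) ^ m * V * (2 * v (P ∩ G.level v F V (m + 1)))
        = (2 * V) ^ (m + 1) * v (P ∩ G.level v F V (m + 1)) := by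
          rw [ENNReal.zpow_add (zero_lt_one.trans h.one_lt_two_mul).ne' h.two_mul_ne_top,
            zpow_one]
          ring
      _ ≤ F (P ∩ G.level v F V (m + 1)) := h1
      _ ≤ F (G.cell (k + 1) x) :=
          measure_mono (Set.inter_subset_left.trans (G.cell_subset (by omega) x))
      _ ≤ (2 * V) ^ m * v (G.cell (k + 1) x) := h2
      _ ≤ (2 * V) ^ m * (V * v P) := by gcongr; exact h.doubling k x
      _ = _ := by ring
  exact (ENNReal.mul_le_mul_iff_right (mul_ne_zero (h.two_mul_zpow_ne_zero m)
    (zero_lt_one.trans_le h.one_le_V).ne')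
    (ENNReal.mul_ne_top (h.two_mul_zpow_ne_top m) h.V_ne_top)).1 h3

lemma v_cell_gen_le (h : G.Admissible v u σ F θ V D K N p q) [Countable ι] {m : ℤ} {x : X}
    (hx : x ∈ G.level v F V m) :
    v (G.cell (G.gen v F V m x) x) ≤
      2 * v (G.cell (G.gen v F V m x) x \ G.level v F V (m + 1)) := by
  have h1 := h.v_cell_gen_inter_le hx
  set P := G.cell (G.gen v F V m x) x with hP
  have h2 := measure_inter_add_sdiff (μ := v) P (G.measurableSet_level v F V (m + 1))
  have h3 : v P + v P ≤ v P + 2 * v (P \ G.level v F V (m + 1)) := by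
    calc v P + v P = 2 * v (P ∩ G.level v F V (m + 1)) + 2 * v (P \ G.level v F V (m + 1)) := by
          rw [← mul_add, h2, two_mul]
      _ ≤ _ := by gcongr
  exact (ENNReal.add_le_add_iff_left (h.v_ne_top _ _)).1 h3

lemma u_cell_gen_inter_le (h : G.Admissible v u σ F θ V D K N p q) [Countable ι] {m : ℤ} {x : X}
    (hx : x ∈ G.level v F V m) :
    u (G.cell (G.gen v F V m x) x ∩ G.level v F V (m + 1)) ≤
      (1 - D⁻¹) * u (G.cell (G.gen v F V m x) x) := by
  have hm := G.measurableSet_level v F V (m + 1)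
  have h1 := h.u_le _ x _ ((G.measurableSet_cell _ _).diff hm) Set.sdiff_subset
    (h.v_cell_gen_le hx)
  have hP := h.u_ne_top (G.gen v F V m x) x
  have hP0 := h.u_ne_zero (G.gen v F V m x) x
  set P := G.cell (G.gen v F V m x) x
  have h2 := measure_inter_add_sdiff (μ := u) P hm
  have hD : D ≠ 0 := by
    rintro rfl
    simp only [zero_mul, nonpos_iff_eq_zero] at h1
    exact hP0 h1
  have h3 : D⁻¹ * u P ≤ u (P \ G.level v F V (m + 1)) := by
    rw [mul_comm, ← div_eq_mul_inv]
    exact ENNReal.div_le_of_le_mul' h1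
  rw [ENNReal.sub_mul fun _ _ => hP, one_mul]
  refine ENNReal.le_sub_of_add_le_left (ENNReal.mul_ne_top (ENNReal.inv_ne_top.2 hD) hP) ?_
  rw [add_comm]
  calc _ ≤ u (P ∩ G.level v F V (m + 1)) + u (P \ G.level v F V (m + 1)) := by gcongr
    _ = u P := h2

/-- Each further level loses the factor `1 - D⁻¹`: the one-step bound is applied in every maximal
cell of level `m + j` inside `P`, and the results are summed. -/
lemma u_cell_gen_inter_le_pow (h : G.Admissible v u σ F θ V D K N p q) [Countable ι] {m : ℤ}
    {x : X} (hx : x ∈ G.level v F V m) (j : ℕ) :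
    u (G.cell (G.gen v F V m x) x ∩ G.level v F V (m + j)) ≤
      (1 - D⁻¹) ^ j * u (G.cell (G.gen v F V m x) x) := by
  induction j with
  | zero => simpa using measure_mono Set.inter_subset_left
  | succ j ih =>
    set P := G.cell (G.gen v F V m x) x
    have hm := G.measurableSet_level v F V (m + j + 1)
    have := (h.isStopping_cell_inter (show m ≤ m + j by omega) hx).measure_le
      (μ := u.restrict (G.level v F V (m + j + 1))) (ν := (1 - D⁻¹) • u) fun y hy => by
        rw [Measure.restrict_apply' hm]
        simpa using h.u_cell_gen_inter_le hy.2
    rw [Measure.restrict_apply' hm, Set.inter_assoc,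
      Set.inter_eq_right.2 (h.level_anti (show m + (j : ℤ) ≤ m + j + 1 by omega))] at this
    push_cast
    rw [← add_assoc]
    refine this.trans ?_
    rw [Measure.smul_apply, smul_eq_mul, pow_succ', mul_assoc]
    gcongr

lemma coef_of_mem (h : G.Admissible v u σ F θ V D K N p q) {m : ℤ} {x : X}
    (hx : x ∈ G.level v F V m) :
    G.coef v F θ V m x = (2 * V) ^ m * θ ^ G.gen v F V m x := by
  refine le_antisymm (iSup_le fun k => ?_) ?_
  · split_ifs with hk
    · gcongr
      · exact h.one_lt_θ.le
      · exact h.le_gen hk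
    · exact zero_le
  · refine le_trans ?_ (le_iSup _ (G.gen v F V m x))
    rw [if_pos (h.lt_avg_gen hx)]

lemma coef_of_notMem {m : ℤ} {x : X} (hx : x ∉ G.level v F V m) : G.coef v F θ V m x = 0 := by
  refine le_antisymm (iSup_le fun k => ?_) zero_le
  rw [if_neg fun hk => hx ⟨k, hk⟩]

/-- The passage from exponent `q` to exponent `p`: in `F ^ q = F ^ p * F ^ (q - p)` Hölder is
applied only to the second factor, and `char_le` removes `u` and `v`. -/
lemma zpow_mul_avg_rpow_le (h : G.Admissible v u σ F θ V D K N p q) (k : ℤ) (x : X) :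
    (θ ^ k * (F (G.cell k x) / v (G.cell k x))) ^ q * u (G.cell k x) ≤
      K ^ q * N ^ (q - p) * ((F (G.cell k x) / σ (G.cell k x)) ^ p * σ (G.cell k x)) := by
  have hp := h.one_lt_p
  have hpq := h.p_lt_q
  have hq := h.q_pos
  have hv0 := h.v_ne_zero k x
  have hvt := h.v_ne_top k x
  have hs0 := h.σ_ne_zero k x
  have hst := h.σ_ne_top k x
  have hchar := h.char_le k x
  have hhol := h.holder k x
  set Q := G.cell k x
  set s := 1 - 1 / p with hs
  have hsp : s * p = p - 1 := by rw [hs]; field_simp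
  have e1 : (θ ^ k) ^ q * (u Q * σ Q ^ (s * q)) ≤ K ^ q * v Q ^ q := by
    have := ENNReal.rpow_le_rpow hchar hq.le
    rwa [ENNReal.mul_rpow_of_nonneg _ _ hq.le, ENNReal.mul_rpow_of_nonneg _ _ hq.le,
      ENNReal.mul_rpow_of_nonneg _ _ hq.le, ← ENNReal.rpow_mul, ← ENNReal.rpow_mul,
      one_div_mul_cancel hq.ne', ENNReal.rpow_one] at this
  have e2 : F Q ^ q ≤ F Q ^ p * (σ Q ^ (s * q) * σ Q ^ (1 - p) * N ^ (q - p)) := by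
    calc F Q ^ q = F Q ^ p * F Q ^ (q - p) := by
          rw [← ENNReal.rpow_add_of_nonneg _ _ (by linarith) (by linarith)]; congr 1; ring
      _ ≤ F Q ^ p * (σ Q ^ s * N) ^ (q - p) := by gcongr
      _ = _ := by
          rw [ENNReal.mul_rpow_of_nonneg _ _ (by linarith), ← ENNReal.rpow_mul,
            ← ENNReal.rpow_add _ _ hs0 hst]
          congr 3
          linear_combination -hsp
  calc (θ ^ k * (F Q / v Q)) ^ q * u Q = (θ ^ k) ^ q * u Q * (v Q ^ q)⁻¹ * F Q ^ q := by
        rw [ENNReal.mul_rpow_of_nonneg _ _ hq.le, ENNReal.div_rpow_of_nonneg _ _ hq.le,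
          div_eq_mul_inv]
        ring
    _ ≤ (θ ^ k) ^ q * u Q * (v Q ^ q)⁻¹ *
          (F Q ^ p * (σ Q ^ (s * q) * σ Q ^ (1 - p) * N ^ (q - p))) := by gcongr
    _ = ((θ ^ k) ^ q * (u Q * σ Q ^ (s * q))) * (v Q ^ q)⁻¹ *
          (F Q ^ p * σ Q ^ (1 - p) * N ^ (q - p)) := by ring
    _ ≤ (K ^ q * v Q ^ q) * (v Q ^ q)⁻¹ * (F Q ^ p * σ Q ^ (1 - p) * N ^ (q - p)) := by gcongr
    _ = K ^ q * (F Q ^ p * σ Q ^ (1 - p) * N ^ (q - p)) := by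
        rw [mul_assoc (K ^ q), ENNReal.mul_inv_cancel
          (ENNReal.rpow_pos hv0.bot_lt hvt).ne'
          (ENNReal.rpow_ne_top_of_nonneg hq.le hvt), mul_one]
    _ = _ := by
        rw [ENNReal.div_rpow_of_nonneg _ _ (by linarith), sub_eq_add_neg 1 p,
          ENNReal.rpow_add _ _ hs0 hst, ENNReal.rpow_one, ENNReal.rpow_neg, div_eq_mul_inv]
        ring

/-- It suffices to compare on one maximal cell `P`. There the coefficient is constant, `u` supplies
the decay in `j`, and `σ P` is replaced by `D * σ (P \ Ω_{m+1})`, where the maximal function is at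
least `F P / σ P`. -/
lemma lintegral_level_coef_le (h : G.Admissible v u σ F θ V D K N p q) [Countable ι] (m : ℤ)
    (j : ℕ) :
    ∫⁻ x in G.level v F V (m + j), G.coef v F θ V m x ^ q ∂u ≤
      (1 - D⁻¹) ^ j * (K ^ q * N ^ (q - p) * D) *
        ∫⁻ x in G.level v F V m \ G.level v F V (m + 1), G.maxAvg F σ x ^ p ∂σ := by
  have hp := h.one_lt_p
  have hq := h.q_pos
  set L := G.level v F V with hL
  have hLm : ∀ m, MeasurableSet (L m) := G.measurableSet_level v F V
  have := (h.isStopping_level m).measure_le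
    (μ := (u.restrict (L (m + j))).withDensity fun x => G.coef v F θ V m x ^ q)
    (ν := ((1 - D⁻¹) ^ j * (K ^ q * N ^ (q - p) * D)) •
      (σ.restrict (L m \ L (m + 1))).withDensity fun x => G.maxAvg F σ x ^ p) fun x hx => by
      set k := G.gen v F V m x with hk
      have hPm := G.measurableSet_cell k x
      rw [Measure.smul_apply, smul_eq_mul, withDensity_apply _ hPm, withDensity_apply _ hPm,
        Measure.restrict_restrict hPm, Measure.restrict_restrict hPm]
      have e1 : ∫⁻ y in G.cell k x ∩ L (m + j), G.coef v F θ V m y ^ q ∂u =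
          G.coef v F θ V m x ^ q * u (G.cell k x ∩ L (m + j)) := by
        rw [← setLIntegral_const]
        refine setLIntegral_congr_fun (hPm.inter (hLm _)) fun y hy => ?_
        have hy' := h.isStopping_level m x hx y hy.1
        rw [h.coef_of_mem hx, h.coef_of_mem hy'.1, hy'.2]
      have e2 : G.cell k x ∩ (L m \ L (m + 1)) = G.cell k x \ L (m + 1) := by
        ext y
        constructor
        · rintro ⟨h1, -, h2⟩; exact ⟨h1, h2⟩
        · rintro ⟨h1, h2⟩; exact ⟨h1, (h.isStopping_level m x hx y h1).1, h2⟩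
      have e3 : (F (G.cell k x) / σ (G.cell k x)) ^ p * σ (G.cell k x \ L (m + 1)) ≤
          ∫⁻ y in G.cell k x \ L (m + 1), G.maxAvg F σ y ^ p ∂σ := by
        rw [← setLIntegral_const]
        refine setLIntegral_mono' (hPm.diff (hLm _)) fun y hy => ?_
        rw [← G.cell_eq_of_mem le_rfl hy.1]
        gcongr
        exact le_iSup (fun k => F (G.cell k y) / σ (G.cell k y)) k
      rw [e1, e2]
      calc G.coef v F θ V m x ^ q * u (G.cell k x ∩ L (m + j))
          ≤ (θ ^ k * (F (G.cell k x) / v (G.cell k x))) ^ q *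
            ((1 - D⁻¹) ^ j * u (G.cell k x)) := by
            gcongr
            · rw [h.coef_of_mem hx, mul_comm]
              gcongr
              exact (h.lt_avg_gen hx).le
            · exact h.u_cell_gen_inter_le_pow hx j
        _ = (1 - D⁻¹) ^ j *
            ((θ ^ k * (F (G.cell k x) / v (G.cell k x))) ^ q * u (G.cell k x)) := by ring
        _ ≤ (1 - D⁻¹) ^ j * (K ^ q * N ^ (q - p) *
            ((F (G.cell k x) / σ (G.cell k x)) ^ p * (D * σ (G.cell k x \ L (m + 1))))) := by
            gcongr _ * ?_
            refine (h.zpow_mul_avg_rpow_le k x).trans ?_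
            gcongr
            exact h.σ_le k x _ (hPm.diff (hLm _)) Set.sdiff_subset (h.v_cell_gen_le hx)
        _ = (1 - D⁻¹) ^ j * (K ^ q * N ^ (q - p) * D) *
            ((F (G.cell k x) / σ (G.cell k x)) ^ p * σ (G.cell k x \ L (m + 1))) := by ring
        _ ≤ _ := by gcongr
  rw [Measure.smul_apply, smul_eq_mul, withDensity_apply _ (hLm m), withDensity_apply _ (hLm m),
    Measure.restrict_restrict (hLm m), Measure.restrict_restrict (hLm m),
    Set.inter_eq_right.2 (h.level_anti (show m ≤ m + j by omega)),
    Set.inter_eq_right.2 Set.sdiff_subset] at this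
  exact this

lemma tsum_lintegral_diff_le (h : G.Admissible v u σ F θ V D K N p q) [Countable ι] :
    ∑' m : ℤ, ∫⁻ x in G.level v F V m \ G.level v F V (m + 1), G.maxAvg F σ x ^ p ∂σ ≤
      ∫⁻ x, G.maxAvg F σ x ^ p ∂σ := by
  have hm : ∀ m : ℤ, MeasurableSet (G.level v F V m \ G.level v F V (m + 1)) := fun m =>
    (G.measurableSet_level v F V m).diff (G.measurableSet_level v F V (m + 1))
  rw [← lintegral_iUnion hm]
  · exact setLIntegral_le_lintegral _ _
  · intro m m' hne
    refine Set.disjoint_left.2 fun x hx hx' => hne ?_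
    by_contra hne'
    rcases lt_or_gt_of_ne hne' with hlt | hlt
    · exact hx.2 (h.level_anti (by omega) hx'.1)
    · exact hx'.2 (h.level_anti (by omega) hx.1)

/-- Generations are grouped by the `m` with average in `((2V)^m, (2V)^(m+1)]`. Those in group `m`
are at most `gen m x`, so `∑ θ ^ k` is geometric and dominated by its top term. -/
lemma fracSum_le (h : G.Admissible v u σ F θ V D K N p q) (x : X) :
    G.fracSum v F θ x ≤ 2 * V * (1 - θ⁻¹)⁻¹ * ∑' m, G.coef v F θ V m x := by
  classical
  have hVne : 2 * V ≠ 0 := (zero_lt_one.trans h.one_lt_two_mul).ne'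
  calc G.fracSum v F θ x
      ≤ ∑' k : ℤ, 2 * V * ∑' m : ℤ, (if x ∈ G.level v F V m then
          (2 * V) ^ m * (if k ≤ G.gen v F V m x then θ ^ k else 0) else 0) := by
        refine ENNReal.tsum_le_tsum fun k => ?_
        set A := F (G.cell k x) / v (G.cell k x) with hA
        rcases eq_or_ne A 0 with hA0 | hA0
        · simp [hA0]
        have hAt : A ≠ ∞ := (ENNReal.div_lt_top (h.F_ne_top k x) (h.v_ne_zero k x)).ne
        obtain ⟨m, hm, hm'⟩ := ENNReal.exists_mem_Ioc_zpow hA0 hAt h.one_lt_two_mul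
          h.two_mul_ne_top
        calc θ ^ k * A ≤ θ ^ k * (2 * V) ^ (m + 1) := by gcongr
          _ = 2 * V * ((2 * V) ^ m * θ ^ k) := by
              rw [ENNReal.zpow_add hVne h.two_mul_ne_top, zpow_one]; ring
          _ ≤ _ := by
              gcongr
              refine le_trans ?_ (ENNReal.le_tsum m)
              rw [if_pos ⟨k, hm⟩, if_pos (h.le_gen hm)]
    _ = 2 * V * ∑' m : ℤ, ∑' k : ℤ, (if x ∈ G.level v F V m then
          (2 * V) ^ m * (if k ≤ G.gen v F V m x then θ ^ k else 0) else 0) := by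
        rw [ENNReal.tsum_mul_left, ENNReal.tsum_comm]
    _ = 2 * V * ∑' m : ℤ, (1 - θ⁻¹)⁻¹ * G.coef v F θ V m x := by
        congr 1
        refine tsum_congr fun m => ?_
        by_cases hx : x ∈ G.level v F V m
        · simp only [hx, if_true]
          rw [ENNReal.tsum_mul_left, tsum_zpow_of_le h.one_lt_θ h.θ_ne_top, h.coef_of_mem hx]
          ring
        · simp [hx, coef_of_notMem hx]
    _ = _ := by rw [ENNReal.tsum_mul_left]; ring

/-- If `M` is the last level containing `x`, the term `j = M - m` of the right-hand sum `Z` gives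
`coef m ≤ Z ^ (1/q) * s ^ (-(M - m)/q)`, which sums geometrically over `m ≤ M`. The weight `s ^ j`
is paid for later by the decay of `u`. -/
lemma tsum_coef_rpow_le (h : G.Admissible v u σ F θ V D K N p q) {s : ℝ≥0∞} (hs : 1 < s)
    (hs' : s ≠ ∞) (x : X) :
    (∑' m, G.coef v F θ V m x) ^ q ≤ ((1 - (s ^ (1 / q))⁻¹)⁻¹) ^ q *
      ∑' (j : ℕ) (m : ℤ), s ^ j *
        (G.level v F V (m + j)).indicator (fun x => G.coef v F θ V m x ^ q) x := by
  have hq := h.q_pos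
  set Z := ∑' (j : ℕ) (m : ℤ), s ^ j *
        (G.level v F V (m + j)).indicator (fun x => G.coef v F θ V m x ^ q) x with hZ
  have hZle : ∀ (j : ℕ) (m : ℤ), x ∈ G.level v F V (m + j) →
      s ^ j * G.coef v F θ V m x ^ q ≤ Z := by
    intro j m hx
    refine le_trans ?_ (ENNReal.le_tsum j)
    refine le_trans ?_ (ENNReal.le_tsum m)
    rw [Set.indicator_of_mem hx]
  set r := s ^ (1 / q) with hr
  have hr1 : 1 < r := ENNReal.one_lt_rpow hs (by positivity)
  have hrt : r ≠ ∞ := ENNReal.rpow_ne_top_of_nonneg (by positivity) hs'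
  have hr0 : r ≠ 0 := (zero_lt_one.trans hr1).ne'
  by_cases hne : ∃ m, x ∈ G.level v F V m
  swap
  · push Not at hne
    simp [coef_of_notMem (hne _), hq]
  by_cases hall : ∀ m, x ∈ G.level v F V m
  -- With no last level, a single positive coefficient occurs in `Z` with every weight `s ^ j`.
  · have hZtop : Z = ∞ := by
      obtain ⟨m, hm⟩ := hne
      have hc : G.coef v F θ V m x ^ q ≠ 0 := by
        have h1 := h.two_mul_zpow_ne_zero m
        have h2 := (ENNReal.zpow_pos h.θ_ne_zero h.θ_ne_top (G.gen v F V m x)).ne'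
        rw [h.coef_of_mem hm]
        simp [h1, h2, hq, hq.not_gt, ENNReal.rpow_eq_zero_iff]
      by_contra hZt
      have h1 : Z / G.coef v F θ V m x ^ q < ∞ := ENNReal.div_lt_top hZt hc
      obtain ⟨j, hj⟩ := ((ENNReal.tendsto_pow_atTop_nhds_top_iff.2 hs).eventually
        (lt_mem_nhds h1)).exists
      have h3 := hZle j m (hall _)
      have h4 : s ^ j ≤ Z / G.coef v F θ V m x ^ q := by
        rw [ENNReal.le_div_iff_mul_le (.inl hc) (.inr hZt)]
        exact h3
      exact absurd hj (not_lt.2 h4)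
    have h1 : ((1 - r⁻¹)⁻¹) ^ q ≠ 0 := by
      simp [ENNReal.rpow_eq_zero_iff, hq, hq.not_gt]
    rw [hZtop, ENNReal.mul_top h1]
    exact le_top
  push Not at hall
  obtain ⟨m₁, hm₁⟩ := hall
  obtain ⟨M, hM, hM'⟩ := Int.exists_greatest_of_bdd
    ⟨m₁, fun m hm => not_lt.1 fun hlt => hm₁ (h.level_anti hlt.le hm)⟩ hne
  have hle : ∀ m, G.coef v F θ V m x ≤ Z ^ (1 / q) * (r ^ M)⁻¹ * (if m ≤ M then r ^ m else 0) := by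
    intro m
    split_ifs with hmM
    · obtain ⟨j, rfl⟩ : ∃ j : ℕ, M = m + j := ⟨(M - m).toNat, by omega⟩
      have h1 : r ^ j * G.coef v F θ V m x ≤ Z ^ (1 / q) := by
        rw [one_div, ENNReal.le_rpow_inv_iff hq]
        refine le_trans (le_of_eq ?_) (hZle j m hM)
        rw [ENNReal.mul_rpow_of_nonneg _ _ hq.le, hr, ← ENNReal.rpow_natCast,
          ← ENNReal.rpow_mul, ← ENNReal.rpow_mul, ← ENNReal.rpow_natCast]
        congr 2
        field_simp
      have hj0 : r ^ j ≠ 0 := pow_ne_zero _ hr0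
      have hjt : r ^ j ≠ ∞ := ENNReal.pow_ne_top hrt
      have hm0 := (ENNReal.zpow_pos hr0 hrt m).ne'
      have hmt := ENNReal.zpow_ne_top hr0 hrt m
      rw [ENNReal.zpow_add hr0 hrt, zpow_natCast, ENNReal.mul_inv (.inl hm0) (.inl hmt)]
      calc G.coef v F θ V m x = r ^ j * G.coef v F θ V m x * (r ^ j)⁻¹ * (r ^ m * (r ^ m)⁻¹) := by
            rw [ENNReal.mul_inv_cancel hm0 hmt, mul_one, mul_comm, ← mul_assoc,
              ENNReal.inv_mul_cancel hj0 hjt, one_mul]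
        _ ≤ Z ^ (1 / q) * (r ^ j)⁻¹ * (r ^ m * (r ^ m)⁻¹) := by gcongr
        _ = _ := by ring
    · rw [coef_of_notMem fun hx => hmM (hM' m hx)]
      exact zero_le
  have hM0 := (ENNReal.zpow_pos hr0 hrt M).ne'
  have hMt := ENNReal.zpow_ne_top hr0 hrt M
  calc (∑' m, G.coef v F θ V m x) ^ q
      ≤ (∑' m, Z ^ (1 / q) * (r ^ M)⁻¹ * (if m ≤ M then r ^ m else 0)) ^ q := by
        gcongr with m; exact hle m
    _ = ((1 - r⁻¹)⁻¹ * Z ^ (1 / q)) ^ q := by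
        rw [ENNReal.tsum_mul_left, tsum_zpow_of_le hr1 hrt]
        congr 1
        rw [mul_assoc, ← mul_assoc _ (r ^ M), ENNReal.inv_mul_cancel hM0 hMt, one_mul, mul_comm]
    _ = _ := by
        rw [ENNReal.mul_rpow_of_nonneg _ _ hq.le, ← ENNReal.rpow_mul, one_div_mul_cancel hq.ne',
          ENNReal.rpow_one]

/-- The dyadic fractional integral is bounded from `L ^ p (σ)` to `L ^ q (u)`. -/
theorem lintegral_fracSum_rpow_le (h : G.Admissible v u σ F θ V D K N p q) [Countable ι]
    {s : ℝ≥0∞} (hs : 1 < s) (hs' : s ≠ ∞) :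
    ∫⁻ x, G.fracSum v F θ x ^ q ∂u ≤
      (2 * V * (1 - θ⁻¹)⁻¹) ^ q * ((1 - (s ^ (1 / q))⁻¹)⁻¹) ^ q *
        ((1 - s * (1 - D⁻¹))⁻¹ * (K ^ q * N ^ (q - p) * D) * ∫⁻ x, G.maxAvg F σ x ^ p ∂σ) := by
  have hq := h.q_pos
  set L := G.level v F V with hL
  have hLm : ∀ m, MeasurableSet (L m) := G.measurableSet_level v F V
  have hcm : ∀ m, Measurable fun x => G.coef v F θ V m x ^ q := fun m =>
    (G.measurable_coef v F θ V m).pow_const q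
  have hmeas : ∀ (j : ℕ) (m : ℤ), Measurable fun x =>
      s ^ j * (L (m + j)).indicator (fun x => G.coef v F θ V m x ^ q) x := fun j m =>
    ((hcm m).indicator (hLm _)).const_mul _
  calc ∫⁻ x, G.fracSum v F θ x ^ q ∂u
      ≤ ∫⁻ x, (2 * V * (1 - θ⁻¹)⁻¹) ^ q * ((1 - (s ^ (1 / q))⁻¹)⁻¹) ^ q *
          ∑' (j : ℕ) (m : ℤ), s ^ j *
            (L (m + j)).indicator (fun x => G.coef v F θ V m x ^ q) x ∂u := by
        refine lintegral_mono fun x => ?_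
        calc G.fracSum v F θ x ^ q
            ≤ (2 * V * (1 - θ⁻¹)⁻¹ * ∑' m, G.coef v F θ V m x) ^ q := by
              gcongr; exact h.fracSum_le x
          _ ≤ _ := by
              rw [ENNReal.mul_rpow_of_nonneg _ _ hq.le, mul_assoc (_ ^ q)]
              gcongr _ * ?_
              exact h.tsum_coef_rpow_le hs hs' x
    _ = (2 * V * (1 - θ⁻¹)⁻¹) ^ q * ((1 - (s ^ (1 / q))⁻¹)⁻¹) ^ q *
          ∑' (j : ℕ), s ^ j * ∑' (m : ℤ), ∫⁻ x in L (m + j), G.coef v F θ V m x ^ q ∂u := by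
        rw [lintegral_const_mul _ (Measurable.tsum fun j =>
          Measurable.tsum fun m => hmeas j m),
          lintegral_tsum fun j => (Measurable.tsum fun m => hmeas j m).aemeasurable]
        congr 1
        refine tsum_congr fun j => ?_
        rw [lintegral_tsum fun m => (hmeas j m).aemeasurable, ← ENNReal.tsum_mul_left]
        refine tsum_congr fun m => ?_
        rw [lintegral_const_mul _ ((hcm m).indicator (hLm _)), lintegral_indicator (hLm _)]
    _ ≤ (2 * V * (1 - θ⁻¹)⁻¹) ^ q * ((1 - (s ^ (1 / q))⁻¹)⁻¹) ^ q *
          ∑' (j : ℕ), s ^ j * ((1 - D⁻¹) ^ j * (K ^ q * N ^ (q - p) * D) *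
            ∫⁻ x, G.maxAvg F σ x ^ p ∂σ) := by
        gcongr with j
        calc _ ≤ ∑' m, (1 - D⁻¹) ^ j * (K ^ q * N ^ (q - p) * D) *
              ∫⁻ x in L m \ L (m + 1), G.maxAvg F σ x ^ p ∂σ := by
              gcongr with m; exact h.lintegral_level_coef_le m j
          _ ≤ _ := by rw [ENNReal.tsum_mul_left]; gcongr; exact h.tsum_lintegral_diff_le
    -- The geometric series has ratio `s * (1 - D⁻¹)`; the identity holds in `ℝ≥0∞` even if it
    -- diverges, so smallness of `s` is not needed yet.
    _ = _ := by
        congr 1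
        simp_rw [← mul_assoc, ← mul_pow]
        rw [ENNReal.tsum_mul_right, ENNReal.tsum_mul_right, ENNReal.tsum_mul_right,
          ENNReal.tsum_mul_right, ENNReal.tsum_geometric]

end Admissible

end DyadicGrid

/-! ### Cubes and dyadic cubes in Euclidean space -/

section Cubes

variable {n : ℕ}

lemma cube_eq_preimage (a : EuclideanSpace ℝ (Fin n)) (l : ℝ) :
    cube a l = (WithLp.ofLp : EuclideanSpace ℝ (Fin n) → Fin n → ℝ) ⁻¹'
      Set.univ.pi fun i => Set.Ico (a i) (a i + l) := by
  ext x; simp [cube]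

lemma measurableSet_cube (a : EuclideanSpace ℝ (Fin n)) (l : ℝ) : MeasurableSet (cube a l) := by
  rw [cube_eq_preimage]
  exact (PiLp.volume_preserving_ofLp (Fin n)).measurable
    (MeasurableSet.univ_pi fun i => measurableSet_Ico)

lemma volume_cube (a : EuclideanSpace ℝ (Fin n)) (l : ℝ) :
    volume (cube a l) = ENNReal.ofReal l ^ n := by
  rw [cube_eq_preimage, (PiLp.volume_preserving_ofLp (Fin n)).measure_preimage
    (MeasurableSet.univ_pi fun i => measurableSet_Ico).nullMeasurableSet, Real.volume_pi_Ico]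
  simp

lemma volume_cube_ne_zero (a : EuclideanSpace ℝ (Fin n)) {l : ℝ} (hl : 0 < l) :
    volume (cube a l) ≠ 0 := by
  rw [volume_cube]; exact pow_ne_zero _ (by simpa using hl)

lemma volume_cube_ne_top (a : EuclideanSpace ℝ (Fin n)) (l : ℝ) : volume (cube a l) ≠ ∞ := by
  rw [volume_cube]; exact ENNReal.pow_ne_top ENNReal.ofReal_ne_top

end Cubes

/-! ### Shifted dyadic grids and the one-third trick. -/

/-- The translation of the grid of generation `k` relative to the standard dyadic grid, in units of
the side length. -/
noncomputable def dyadicShift (b : Bool) (k : ℤ) : ℝ :=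
  if b then (if Even k then 1 / 3 else -(1 / 3)) else 0

/-- The alternating sign keeps the shifted grids nested: `(1/3 - 1)/2 = -1/3` and `(-1/3 + 1)/2 =
1/3`. -/
lemma exists_dyadicShift_eq (b : Bool) (k : ℤ) :
    ∃ d : ℤ, dyadicShift b (k + 1) = (dyadicShift b k - d) / 2 := by
  unfold dyadicShift
  cases b
  · exact ⟨0, by simp⟩
  · by_cases h : Even k
    · have h' : ¬ Even (k + 1) := by rwa [Int.even_add_one, not_not]
      exact ⟨1, by simp only [h, h', if_true, if_false]; norm_num⟩
    · have h' : Even (k + 1) := by rwa [Int.even_add_one]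
      exact ⟨-1, by simp only [h, h', if_true, if_false]; norm_num⟩

lemma floor_dyadicShift_succ (b : Bool) (k : ℤ) {x y : ℝ}
    (h : ⌊x / 2 ^ k + dyadicShift b k⌋ = ⌊y / 2 ^ k + dyadicShift b k⌋) :
    ⌊x / 2 ^ (k + 1) + dyadicShift b (k + 1)⌋ = ⌊y / 2 ^ (k + 1) + dyadicShift b (k + 1)⌋ := by
  obtain ⟨d, hd⟩ := exists_dyadicShift_eq b k
  have key : ∀ z : ℝ, ⌊z / 2 ^ (k + 1) + dyadicShift b (k + 1)⌋ =
      (⌊z / 2 ^ k + dyadicShift b k⌋ - d) / 2 := by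
    intro z
    have h1 := Int.floor_div_natCast (z / 2 ^ k + dyadicShift b k - d) 2
    rw [Int.floor_sub_intCast] at h1
    push_cast at h1
    rw [← h1, hd, zpow_add₀ two_ne_zero, zpow_one]
    congr 1
    field_simp
    ring
  rw [key, key, h]

/-- If an integer separates the two points, both are within `1/3` of it, so a shift by `1/3` in
either direction brings both to the same side. -/
lemma exists_floor_add_dyadicShift_eq (k : ℤ) {a b : ℝ} (hab : |a - b| ≤ 1 / 3) :
    ∃ t : Bool, ⌊a + dyadicShift t k⌋ = ⌊b + dyadicShift t k⌋ := by
  wlog hle : a ≤ b generalizing a b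
  · obtain ⟨t, ht⟩ := this (a := b) (b := a) (by rwa [abs_sub_comm]) (le_of_not_ge hle)
    exact ⟨t, ht.symm⟩
  by_cases h : ⌊a⌋ = ⌊b⌋
  · exact ⟨false, by simpa [dyadicShift] using h⟩
  have h1 : b ≤ a + 1 / 3 := by
    have := neg_le_of_abs_le hab
    linarith
  have h2 : a < ⌊b⌋ := Int.floor_lt.1 (lt_of_le_of_ne (Int.floor_mono hle) h)
  have h3 := Int.floor_le b
  refine ⟨true, ?_⟩
  simp only [dyadicShift, if_true]
  split_ifs
  · have e1 : ⌊a + 1 / 3⌋ = ⌊b⌋ := Int.floor_eq_iff.2 ⟨by linarith, by linarith⟩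
    have e2 : ⌊b + 1 / 3⌋ = ⌊b⌋ := Int.floor_eq_iff.2 ⟨by linarith, by linarith⟩
    rw [e1, e2]
  · have e1 : ⌊a + -(1 / 3)⌋ = ⌊b⌋ - 1 :=
      Int.floor_eq_iff.2 ⟨by push_cast; linarith, by push_cast; linarith⟩
    have e2 : ⌊b + -(1 / 3)⌋ = ⌊b⌋ - 1 :=
      Int.floor_eq_iff.2 ⟨by push_cast; linarith, by push_cast; linarith⟩
    rw [e1, e2]

/-- The dyadic grid in Euclidean space whose shift in the `i`-th coordinate is given by `t i`. -/
noncomputable def euclideanGrid {n : ℕ} (t : Fin n → Bool) :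
    DyadicGrid (EuclideanSpace ℝ (Fin n)) (Fin n → ℤ) where
  idx k x i := ⌊x i / 2 ^ k + dyadicShift (t i) k⌋
  measurableSet_preimage k j := by
    refine (measurable_pi_lambda _ fun i => ?_) (MeasurableSet.singleton j)
    have : Measurable fun x : EuclideanSpace ℝ (Fin n) => x i := by fun_prop
    exact ((this.div_const _).add_const _).floor
  nested k x y h := by
    funext i
    exact floor_dyadicShift_succ _ k (congrFun h i)

lemma cell_euclideanGrid {n : ℕ} (t : Fin n → Bool) (k : ℤ) (x : EuclideanSpace ℝ (Fin n)) :
    ∃ a, (euclideanGrid t).cell k x = cube a (2 ^ k) := by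
  refine ⟨WithLp.toLp 2 fun i =>
    2 ^ k * ((⌊x i / 2 ^ k + dyadicShift (t i) k⌋ : ℝ) - dyadicShift (t i) k), ?_⟩
  have h2 : (0 : ℝ) < 2 ^ k := by positivity
  ext y
  simp only [DyadicGrid.cell, euclideanGrid, cube, Set.mem_ofPred_eq, funext_iff]
  refine forall_congr' fun i => ?_
  rw [Int.floor_eq_iff, ← mul_add_one, mul_comm, ← le_div_iff₀ h2, mul_comm, ← div_lt_iff₀ h2]
  constructor
  · rintro ⟨h3, h4⟩; constructor <;> linarith
  · rintro ⟨h3, h4⟩; constructor <;> linarith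

lemma ENNReal.ofReal_two_zpow (k : ℤ) : ENNReal.ofReal (2 ^ k) = 2 ^ k := by
  rw [← ENNReal.rpow_intCast, ← ENNReal.ofReal_ofNat 2,
    ENNReal.ofReal_rpow_of_pos (by norm_num), Real.rpow_intCast]

lemma volume_cell_euclideanGrid {n : ℕ} (t : Fin n → Bool) (k : ℤ)
    (x : EuclideanSpace ℝ (Fin n)) :
    volume ((euclideanGrid t).cell k x) = ((2 : ℝ≥0∞) ^ k) ^ n := by
  obtain ⟨a, ha⟩ := cell_euclideanGrid t k x
  rw [ha, volume_cube, ENNReal.ofReal_two_zpow]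

lemma exists_mem_cell_euclideanGrid {n : ℕ} (k : ℤ) {x y : EuclideanSpace ℝ (Fin n)}
    (h : 3 * ‖x - y‖ ≤ 2 ^ k) : ∃ t, y ∈ (euclideanGrid t).cell k x := by
  have h2 : (0 : ℝ) < 2 ^ k := by positivity
  have : ∀ i, ∃ t : Bool,
      ⌊y i / 2 ^ k + dyadicShift t k⌋ = ⌊x i / 2 ^ k + dyadicShift t k⌋ := by
    intro i
    refine exists_floor_add_dyadicShift_eq k ?_
    rw [← sub_div, abs_div, abs_of_pos h2, div_le_iff₀ h2, abs_sub_comm]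
    have : |x i - y i| ≤ ‖x - y‖ := by
      simpa using PiLp.norm_apply_le (x - y) i
    linarith
  choose t ht using this
  exact ⟨t, funext ht⟩

/-- The kernel of the fractional integral is dominated by the kernels of the dyadic fractional
integrals over the shifted grids. -/
lemma exists_kernel_le {n : ℕ} {α : ℝ} (hαn : α < n) {x y : EuclideanSpace ℝ (Fin n)}
    (hxy : x ≠ y) : ∃ (t : Fin n → Bool) (k : ℤ), y ∈ (euclideanGrid t).cell k x ∧
      (ENNReal.ofReal ‖x - y‖ ^ (n - α))⁻¹ ≤
        6 ^ (n - α) * (((2 : ℝ≥0∞) ^ α) ^ k / volume ((euclideanGrid t).cell k x)) := by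
  have h0 : 0 < ‖x - y‖ := norm_pos_iff.2 (sub_ne_zero.2 hxy)
  have hb : 0 ≤ n - α := by linarith
  -- Generation `k + 1` is the first that is large enough for a common cell; its side is less than
  -- `6 * ‖x - y‖`, whence the constant.
  obtain ⟨k, hk, hk'⟩ := ENNReal.exists_mem_Ioc_zpow (x := 3 * ENNReal.ofReal ‖x - y‖)
    (by simpa using h0) (ENNReal.mul_ne_top (by simp) ENNReal.ofReal_ne_top)
    ENNReal.one_lt_two (by simp)
  have h20 : (2 : ℝ≥0∞) ≠ 0 := by simp
  have h2t : (2 : ℝ≥0∞) ≠ ∞ := by simp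
  have hk0 := (ENNReal.zpow_pos h20 h2t (k + 1)).ne'
  have hkt := ENNReal.zpow_ne_top h20 h2t (k + 1)
  have h3 : 3 * ‖x - y‖ ≤ 2 ^ (k + 1) := by
    rw [← ENNReal.ofReal_two_zpow] at hk'
    have e : (3 : ℝ≥0∞) * ENNReal.ofReal ‖x - y‖ = ENNReal.ofReal (3 * ‖x - y‖) := by
      rw [ENNReal.ofReal_mul (by norm_num)]; simp
    rw [e] at hk'
    exact (ENNReal.ofReal_le_ofReal_iff (by positivity)).1 hk'
  obtain ⟨t, ht⟩ := exists_mem_cell_euclideanGrid (k + 1) h3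
  refine ⟨t, k + 1, ht, ?_⟩
  have h4 : (2 : ℝ≥0∞) ^ (k + 1) ≤ 6 * ENNReal.ofReal ‖x - y‖ := by
    rw [ENNReal.zpow_add h20 h2t, zpow_one]
    calc (2 : ℝ≥0∞) ^ k * 2 ≤ (3 * ENNReal.ofReal ‖x - y‖) * 2 := by gcongr
      _ = _ := by rw [mul_comm, ← mul_assoc]; norm_num
  rw [volume_cell_euclideanGrid, ← ENNReal.rpow_zpow_comm, ← ENNReal.rpow_natCast,
    ← ENNReal.rpow_sub _ _ hk0 hkt, ← neg_sub (n : ℝ), ENNReal.rpow_neg, ← div_eq_mul_inv,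
    ENNReal.inv_le_iff_inv_le, ENNReal.inv_div]
  · refine ENNReal.div_le_of_le_mul' ?_
    rw [← ENNReal.mul_rpow_of_nonneg _ _ hb]
    gcongr
  · exact .inl (ENNReal.rpow_ne_top_of_nonneg hb hkt)
  · exact .inl (ENNReal.rpow_pos hk0.bot_lt hkt).ne'

lemma enorm_fracIntegrand_le {n : ℕ} {α : ℝ} (hαn : α < n) (f : EuclideanSpace ℝ (Fin n) → ℝ)
    (x y : EuclideanSpace ℝ (Fin n)) :
    ‖fracIntegrand α f x y‖ₑ ≤ 6 ^ (n - α) * ∑ t : Fin n → Bool, ∑' k : ℤ,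
      ((2 : ℝ≥0∞) ^ α) ^ k / volume ((euclideanGrid t).cell k x) *
        ((euclideanGrid t).cell k x).indicator (fun y => ‖f y‖ₑ) y := by
  have hb : 0 < n - α := by linarith
  -- On the diagonal the integrand is zero, by division by zero.
  rcases eq_or_ne x y with rfl | hxy
  · simp [fracIntegrand, Real.zero_rpow hb.ne']
  have h0 : 0 < ‖x - y‖ := norm_pos_iff.2 (sub_ne_zero.2 hxy)
  obtain ⟨t, k, hy, hle⟩ := exists_kernel_le hαn hxy
  have e : ‖fracIntegrand α f x y‖ₑ = (ENNReal.ofReal ‖x - y‖ ^ (n - α))⁻¹ * ‖f y‖ₑ := by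
    rw [fracIntegrand, div_eq_mul_inv, enorm_mul, mul_comm, enorm_inv (by positivity),
      ENNReal.ofReal_rpow_of_pos h0, Real.enorm_of_nonneg (by positivity)]
  rw [e]
  calc _ ≤ 6 ^ (n - α) * (((2 : ℝ≥0∞) ^ α) ^ k / volume ((euclideanGrid t).cell k x)) *
        ‖f y‖ₑ := by gcongr
    _ = 6 ^ (n - α) * (((2 : ℝ≥0∞) ^ α) ^ k / volume ((euclideanGrid t).cell k x) *
        ((euclideanGrid t).cell k x).indicator (fun y => ‖f y‖ₑ) y) := by
        rw [Set.indicator_of_mem hy, mul_assoc]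
    _ ≤ _ := by
        gcongr
        refine le_trans ?_ (Finset.single_le_sum (fun _ _ => zero_le) (Finset.mem_univ t))
        exact ENNReal.le_tsum (f := fun k : ℤ =>
          ((2 : ℝ≥0∞) ^ α) ^ k / volume ((euclideanGrid t).cell k x) *
            ((euclideanGrid t).cell k x).indicator (fun y => ‖f y‖ₑ) y) k

lemma lintegral_enorm_fracIntegrand_le {n : ℕ} {α : ℝ} (hαn : α < n)
    {f : EuclideanSpace ℝ (Fin n) → ℝ} (hf : Measurable f) (x : EuclideanSpace ℝ (Fin n)) :
    ∫⁻ y, ‖fracIntegrand α f x y‖ₑ ≤ 6 ^ (n - α) * ∑ t : Fin n → Bool,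
      (euclideanGrid t).fracSum volume (volume.withDensity fun y => ‖f y‖ₑ) (2 ^ α) x := by
  have hm : ∀ (t : Fin n → Bool) (k : ℤ), Measurable
      (((euclideanGrid t).cell k x).indicator (fun y => ‖f y‖ₑ)) := fun t k =>
    hf.enorm.indicator ((euclideanGrid t).measurableSet_cell k x)
  calc ∫⁻ y, ‖fracIntegrand α f x y‖ₑ
      ≤ ∫⁻ y, 6 ^ (n - α) * ∑ t : Fin n → Bool, ∑' k : ℤ,
        ((2 : ℝ≥0∞) ^ α) ^ k / volume ((euclideanGrid t).cell k x) *
          ((euclideanGrid t).cell k x).indicator (fun y => ‖f y‖ₑ) y :=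
        lintegral_mono fun y => enorm_fracIntegrand_le hαn f x y
    _ = _ := by
        rw [lintegral_const_mul _ (Finset.measurable_fun_sum _ fun t _ => Measurable.tsum fun k =>
          (hm t k).const_mul _), lintegral_finsetSum _ fun t _ => Measurable.tsum fun k =>
          (hm t k).const_mul _]
        congr 1
        refine Finset.sum_congr rfl fun t _ => ?_
        rw [lintegral_tsum fun k => ((hm t k).const_mul _).aemeasurable]
        refine tsum_congr fun k => ?_
        have hc := (euclideanGrid t).measurableSet_cell k x
        rw [lintegral_const_mul _ (hm t k), lintegral_indicator hc, withDensity_apply _ hc,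
          ENNReal.mul_comm_div]

/-! ### Consequences of the `A_{p,q}` condition -/

/-- Hölder's inequality with three factors, one of them constant. -/
lemma measure_le_mul_lintegral_rpow {X : Type*} [MeasurableSpace X] {v : Measure X} {g : X → ℝ≥0∞}
    (hg : Measurable g) (hg₀ : ∀ x, g x ≠ 0) (hg' : ∀ x, g x ≠ ∞) {a a' b : ℝ}
    (ha : a'.HolderConjugate a) (hab : a ≤ b) {E Q : Set X} (hEQ : E ⊆ Q) :
    v E ≤ (∫⁻ x in E, g x ^ (-a') ∂v) ^ (1 / a') * ((∫⁻ x in Q, g x ^ b ∂v) ^ (1 / b) *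
      v Q ^ (1 / a - 1 / b)) := by
  have ha0 := ha.symm.pos
  -- Hölder for `1 = g⁻¹ * g` on `E`; the exponent `a` is then raised to `b` on `Q`.
  have h1 : v E ≤ (∫⁻ x in E, g x ^ (-a') ∂v) ^ (1 / a') * (∫⁻ x in E, g x ^ a ∂v) ^ (1 / a) := by
    have := ENNReal.lintegral_mul_le_Lp_mul_Lq (v.restrict E) ha (f := fun x => (g x)⁻¹) (g := g)
      hg.inv.aemeasurable hg.aemeasurable
    simp only [Pi.mul_apply, ENNReal.inv_mul_cancel (hg₀ _) (hg' _), setLIntegral_one,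
      ENNReal.inv_rpow, ← ENNReal.rpow_neg] at this
    exact this
  have h2 : (∫⁻ x in E, g x ^ a ∂v) ^ (1 / a) ≤
      (∫⁻ x in Q, g x ^ b ∂v) ^ (1 / b) * v Q ^ (1 / a - 1 / b) := by
    have := eLpNorm'_le_eLpNorm'_mul_rpow_measure_univ (μ := v.restrict Q) ha0 hab
      (f := g) hg.aestronglyMeasurable
    simp only [eLpNorm', enorm_eq_self, Measure.restrict_apply .univ, Set.univ_inter] at this
    refine le_trans ?_ this
    gcongr
  exact h1.trans (by gcongr)

/-- A form of the `A_∞` property: subsets of at least half the measure of `Q` carry a fixed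
proportion of the weight `g ^ (-a')`. -/
lemma lintegral_rpow_neg_le_of_measure_le {X : Type*} [MeasurableSpace X] {v : Measure X}
    {g : X → ℝ≥0∞} (hg : Measurable g) (hg₀ : ∀ x, g x ≠ 0) (hg' : ∀ x, g x ≠ ∞) {a a' b : ℝ}
    (ha : a'.HolderConjugate a) (hab : a ≤ b) {E Q : Set X} (hEQ : E ⊆ Q) (hQ : v Q ≤ 2 * v E)
    (hQ₀ : v Q ≠ 0) (hQ' : v Q ≠ ∞) {K : ℝ≥0∞}
    (hK : (∫⁻ x in Q, g x ^ b ∂v) ^ (1 / b) * (∫⁻ x in Q, g x ^ (-a') ∂v) ^ (1 / a') ≤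
      K * v Q ^ (1 / b + 1 / a')) :
    ∫⁻ x in Q, g x ^ (-a') ∂v ≤ (2 * K) ^ a' * ∫⁻ x in E, g x ^ (-a') ∂v := by
  have ha0 := ha.pos
  set I := ∫⁻ x in Q, g x ^ (-a') ∂v
  set J := ∫⁻ x in E, g x ^ (-a') ∂v
  have h1 := measure_le_mul_lintegral_rpow (v := v) hg hg₀ hg' ha hab hEQ
  have h2 : v Q * I ^ (1 / a') ≤ v Q * (2 * K * J ^ (1 / a')) := by
    calc v Q * I ^ (1 / a') ≤ (2 * v E) * I ^ (1 / a') := by gcongr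
      _ ≤ 2 * (J ^ (1 / a') * ((∫⁻ x in Q, g x ^ b ∂v) ^ (1 / b) * v Q ^ (1 / a - 1 / b))) *
          I ^ (1 / a') := by gcongr
      _ = 2 * J ^ (1 / a') * v Q ^ (1 / a - 1 / b) *
          ((∫⁻ x in Q, g x ^ b ∂v) ^ (1 / b) * I ^ (1 / a')) := by ring
      _ ≤ 2 * J ^ (1 / a') * v Q ^ (1 / a - 1 / b) * (K * v Q ^ (1 / b + 1 / a')) := by gcongr
      _ = 2 * K * J ^ (1 / a') * (v Q ^ (1 / a - 1 / b) * v Q ^ (1 / b + 1 / a')) := by ring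
      _ = _ := by
          rw [← ENNReal.rpow_add _ _ hQ₀ hQ']
          have : 1 / a - 1 / b + (1 / b + 1 / a') = 1 := by
            have := ha.symm.inv_add_inv_eq_one
            simp only [one_div]; linarith
          rw [this, ENNReal.rpow_one, mul_comm]
  have h3 := (ENNReal.mul_le_mul_iff_right hQ₀ hQ').1 h2
  have h4 := ENNReal.rpow_le_rpow h3 ha0.le
  rwa [ENNReal.mul_rpow_of_nonneg _ _ ha0.le, ← ENNReal.rpow_mul, ← ENNReal.rpow_mul,
    one_div_mul_cancel ha0.ne', ENNReal.rpow_one, ENNReal.rpow_one] at h4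

section Apq

variable {n : ℕ} {p q : ℝ} {w : EuclideanSpace ℝ (Fin n) → ℝ≥0∞}

lemma mul_le_apqConst (hp : 1 < p) (hq : 0 < q) (a : EuclideanSpace ℝ (Fin n)) {l : ℝ}
    (hl : 0 < l) :
    (∫⁻ x in cube a l, w x ^ q) ^ (1 / q) *
        (∫⁻ x in cube a l, w x ^ (-(p / (p - 1)))) ^ (1 / (p / (p - 1))) ≤
      apqConst p q w * volume (cube a l) ^ (1 / q + 1 / (p / (p - 1))) := by
  have hp' : 0 < p / (p - 1) := div_pos (by linarith) (by linarith)
  have hv0 := volume_cube_ne_zero a hl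
  have hvt := volume_cube_ne_top a l
  have h1 : (⨍⁻ x in cube a l, w x ^ q ∂volume) ^ (1 / q) *
      (⨍⁻ x in cube a l, w x ^ (-(p / (p - 1))) ∂volume) ^ (1 / (p / (p - 1))) ≤
        apqConst p q w :=
    le_iSup_of_le a (le_iSup_of_le l (le_iSup_of_le hl le_rfl))
  rw [setLAverage_eq, setLAverage_eq, ENNReal.div_rpow_of_nonneg _ _ (by positivity),
    ENNReal.div_rpow_of_nonneg _ _ (by positivity)] at h1
  have c1 : volume (cube a l) ^ (1 / q) ≠ 0 := (ENNReal.rpow_pos hv0.bot_lt hvt).ne'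
  have c2 : volume (cube a l) ^ (1 / q) ≠ ∞ := ENNReal.rpow_ne_top_of_nonneg (by positivity) hvt
  have d1 : volume (cube a l) ^ (1 / (p / (p - 1))) ≠ 0 := (ENNReal.rpow_pos hv0.bot_lt hvt).ne'
  have d2 : volume (cube a l) ^ (1 / (p / (p - 1))) ≠ ∞ :=
    ENNReal.rpow_ne_top_of_nonneg (by positivity) hvt
  rw [ENNReal.rpow_add _ _ hv0 hvt]
  set A := ∫⁻ x in cube a l, w x ^ q
  set B := ∫⁻ x in cube a l, w x ^ (-(p / (p - 1)))
  set S := volume (cube a l) ^ (1 / q)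
  set T := volume (cube a l) ^ (1 / (p / (p - 1)))
  calc A ^ (1 / q) * B ^ (1 / (p / (p - 1)))
      = (A ^ (1 / q) / S * S) * (B ^ (1 / (p / (p - 1))) / T * T) := by
        rw [ENNReal.div_mul_cancel c1 c2, ENNReal.div_mul_cancel d1 d2]
    _ = A ^ (1 / q) / S * (B ^ (1 / (p / (p - 1))) / T) * (S * T) := by ring
    _ ≤ _ := by gcongr

/-- The `A_∞` lemma is used twice: for `w` with `(a', a, b) = (p', p, q)`, and for `w⁻¹` with `(q,
q', p')`. This explains the two summands of the constant `D`. -/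
lemma admissible_euclideanGrid {α : ℝ} (hα₀ : 0 < α) (hp : 1 < p) (hpq : p < q)
    (hα : 1 / p - 1 / q = α / n) (hw : Measurable w) (hw₀ : ∀ x, w x ≠ 0) (hw' : ∀ x, w x ≠ ∞)
    {K : ℝ≥0∞} (hK : apqConst p q w ≤ K) (hK' : K ≠ ∞) {φ : EuclideanSpace ℝ (Fin n) → ℝ≥0∞}
    (hφ : Measurable φ) (hN : (∫⁻ x, φ x ^ p * w x ^ p) ^ (1 / p) ≠ ∞) (t : Fin n → Bool) :
    (euclideanGrid t).Admissible volume (volume.withDensity fun x => w x ^ q)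
      (volume.withDensity fun x => w x ^ (-(p / (p - 1)))) (volume.withDensity φ) (2 ^ α) (2 ^ n)
      ((2 * K) ^ (p / (p - 1)) + (2 * K) ^ q) K ((∫⁻ x, φ x ^ p * w x ^ p) ^ (1 / p)) p q := by
  have hq : 0 < q := by linarith
  have hn : (n : ℝ) ≠ 0 := by
    intro h
    have h1 : 1 / q < 1 / p := one_div_lt_one_div_of_lt (by linarith) hpq
    rw [h, div_zero] at hα
    linarith
  set p' := p / (p - 1) with hp'
  have hconj : p.HolderConjugate p' := Real.HolderConjugate.conjExponent hp
  have hconjq : q.HolderConjugate (q / (q - 1)) :=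
    Real.HolderConjugate.conjExponent (by linarith)
  have hp'0 : 0 < p' := hconj.symm.pos
  have hpp' : 1 - 1 / p = 1 / p' := by
    have := hconj.inv_add_inv_eq_one
    simp only [one_div]; linarith
  have h20 : (2 : ℝ≥0∞) ≠ 0 := by simp
  have h2t : (2 : ℝ≥0∞) ≠ ∞ := by simp
  have hv0 : ∀ k x, volume ((euclideanGrid t).cell k x) ≠ 0 := fun k x => by
    rw [volume_cell_euclideanGrid]
    exact pow_ne_zero _ (ENNReal.zpow_pos h20 h2t k).ne'
  have hvt : ∀ k x, volume ((euclideanGrid t).cell k x) ≠ ∞ := fun k x => by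
    rw [volume_cell_euclideanGrid]
    exact ENNReal.pow_ne_top (ENNReal.zpow_ne_top h20 h2t k)
  have hu : ∀ Q, MeasurableSet Q → (volume.withDensity fun x => w x ^ q) Q =
    ∫⁻ x in Q, w x ^ q := fun Q hQ => withDensity_apply _ hQ
  have hσ : ∀ Q, MeasurableSet Q → (volume.withDensity fun x => w x ^ (-p')) Q =
    ∫⁻ x in Q, w x ^ (-p') := fun Q hQ => withDensity_apply _ hQ
  have hcm : ∀ k x, MeasurableSet ((euclideanGrid t).cell k x) :=
    (euclideanGrid t).measurableSet_cell
  have hpos : ∀ (r : ℝ) k x, ∫⁻ y in (euclideanGrid t).cell k x, w y ^ r ≠ 0 := by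
    intro r k x h0
    rw [lintegral_eq_zero_iff (hw.pow_const r)] at h0
    have hne : volume.restrict ((euclideanGrid t).cell k x) ≠ 0 := by
      rw [Ne, Measure.restrict_eq_zero]; exact hv0 k x
    have : (MeasureTheory.ae (volume.restrict ((euclideanGrid t).cell k x))).NeBot :=
      ae_neBot.2 hne
    obtain ⟨y, hy⟩ := h0.exists
    exact (ENNReal.rpow_pos (hw₀ y).bot_lt (hw' y)).ne' hy
  have hmul : ∀ k x, (∫⁻ y in (euclideanGrid t).cell k x, w y ^ q) ^ (1 / q) *
      (∫⁻ y in (euclideanGrid t).cell k x, w y ^ (-p')) ^ (1 / p') ≤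
        K * volume ((euclideanGrid t).cell k x) ^ (1 / q + 1 / p') := by
    intro k x
    obtain ⟨a, ha⟩ := cell_euclideanGrid t k x
    rw [ha]
    exact (mul_le_apqConst hp hq a (by positivity)).trans (by gcongr)
  have hmult : ∀ k x, (∫⁻ y in (euclideanGrid t).cell k x, w y ^ q) ^ (1 / q) *
      (∫⁻ y in (euclideanGrid t).cell k x, w y ^ (-p')) ^ (1 / p') ≠ ∞ := fun k x =>
    ne_top_of_le_ne_top (ENNReal.mul_ne_top hK'
      (ENNReal.rpow_ne_top_of_nonneg (by positivity) (hvt k x))) (hmul k x)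
  -- Both integrals are positive, so finiteness of the product gives finiteness of each.
  have hut : ∀ k x, ∫⁻ y in (euclideanGrid t).cell k x, w y ^ q ≠ ∞ := by
    intro k x htop
    refine hmult k x ?_
    rw [htop, ENNReal.top_rpow_of_pos (by positivity), ENNReal.top_mul]
    simp [ENNReal.rpow_eq_zero_iff, hpos, hp'0, hp'0.not_gt]
  have hσt : ∀ k x, ∫⁻ y in (euclideanGrid t).cell k x, w y ^ (-p') ≠ ∞ := by
    intro k x htop
    refine hmult k x ?_
    rw [htop, ENNReal.top_rpow_of_pos (by positivity), ENNReal.mul_top]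
    simp [ENNReal.rpow_eq_zero_iff, hpos, hq, hq.not_gt]
  have h2K : 2 * K ≠ ∞ := ENNReal.mul_ne_top (by simp) hK'
  refine ⟨hv0, hvt, ?_, ?_, ?_, ?_, ENNReal.one_lt_two_rpow hα₀, ENNReal.two_rpow_ne_top hα₀,
    one_le_pow₀ one_le_two, ENNReal.pow_ne_top h2t,
    ENNReal.add_ne_top.2 ⟨ENNReal.rpow_ne_top_of_nonneg hp'0.le h2K,
      ENNReal.rpow_ne_top_of_nonneg hq.le h2K⟩, hK', hN, hp, hpq, ?_, ?_, ?_, ?_, ?_⟩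
  · intro k x; rw [hu _ (hcm k x)]; exact hpos q k x
  · intro k x; rw [hu _ (hcm k x)]; exact hut k x
  · intro k x; rw [hσ _ (hcm k x)]; exact hpos (-p') k x
  · intro k x; rw [hσ _ (hcm k x)]; exact hσt k x
  · intro k x
    rw [volume_cell_euclideanGrid, volume_cell_euclideanGrid, ENNReal.zpow_add h20 h2t, zpow_one,
      mul_pow, mul_comm]
  · intro k x
    rw [hu _ (hcm k x), hσ _ (hcm k x), hpp']
    have e : ((2 : ℝ≥0∞) ^ α) ^ k = volume ((euclideanGrid t).cell k x) ^ (α / n) := by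
      rw [volume_cell_euclideanGrid, ← ENNReal.rpow_zpow_comm, ← ENNReal.rpow_natCast,
        ← ENNReal.rpow_mul]
      congr 1
      field_simp
    calc _ ≤ volume ((euclideanGrid t).cell k x) ^ (α / n) *
          (K * volume ((euclideanGrid t).cell k x) ^ (1 / q + 1 / p')) := by
          rw [e]; gcongr _ * ?_; exact hmul k x
      _ = _ := by
          rw [mul_left_comm, ← ENNReal.rpow_add _ _ (hv0 k x) (hvt k x), ← hα, ← hpp',
            show 1 / p - 1 / q + (1 / q + (1 - 1 / p)) = 1 by ring, ENNReal.rpow_one]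
  · intro k x
    rw [hσ _ (hcm k x), hpp', withDensity_apply _ (hcm k x), mul_comm]
    -- Hölder for `φ = (φ * w) * w⁻¹` on the cell.
    have := ENNReal.lintegral_mul_le_Lp_mul_Lq
      (volume.restrict ((euclideanGrid t).cell k x)) hconj
      (f := fun x => φ x * w x) (g := fun x => (w x)⁻¹) (hφ.mul hw).aemeasurable
      hw.inv.aemeasurable
    simp only [Pi.mul_apply, mul_assoc, ENNReal.mul_inv_cancel (hw₀ _) (hw' _), mul_one,
      ENNReal.inv_rpow, ← ENNReal.rpow_neg, ENNReal.mul_rpow_of_nonneg _ _ hconj.nonneg] at this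
    refine this.trans ?_
    gcongr
    exact Measure.restrict_le_self
  · intro k x E hE hEQ hle
    rw [hu _ (hcm k x), hu _ hE]
    have := lintegral_rpow_neg_le_of_measure_le (g := fun x => (w x)⁻¹) hw.inv
      (fun x => ENNReal.inv_ne_zero.2 (hw' x)) (fun x => ENNReal.inv_ne_top.2 (hw₀ x)) hconjq
      (b := p') ?_ hEQ hle (hv0 k x) (hvt k x) (K := K) ?_
    · simp only [ENNReal.inv_rpow, ← ENNReal.rpow_neg, neg_neg] at this
      refine this.trans ?_
      gcongr
      exact le_add_self
    · rw [hp', div_le_div_iff₀ (by linarith) (by linarith)]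
      nlinarith
    · simp only [ENNReal.inv_rpow, ← ENNReal.rpow_neg, neg_neg]
      rw [mul_comm, add_comm]
      exact hmul k x
  · intro k x E hE hEQ hle
    rw [hσ _ (hcm k x), hσ _ hE]
    refine (lintegral_rpow_neg_le_of_measure_le hw hw₀ hw' hconj.symm hpq.le hEQ hle (hv0 k x)
      (hvt k x) (hmul k x)).trans ?_
    gcongr
    exact le_self_add

end Apq

/-- The weighted inequality for the fractional integral of a nonnegative function, for weights that
are positive and finite everywhere. -/
theorem exists_lintegral_fracIntegrand_le {n : ℕ} {α p q : ℝ} (hα₀ : 0 < α) (hαn : α < n)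
    (hp : 1 < p) (hpq : p < q) (hα : 1 / p - 1 / q = α / n) {K : ℝ≥0∞} (hK' : K ≠ ∞) :
    ∃ C : ℝ≥0∞, C ≠ ∞ ∧ ∀ w : EuclideanSpace ℝ (Fin n) → ℝ≥0∞, Measurable w → (∀ x, w x ≠ 0) →
      (∀ x, w x ≠ ∞) → apqConst p q w ≤ K → ∀ f : EuclideanSpace ℝ (Fin n) → ℝ, Measurable f →
      (∫⁻ x, ‖f x‖ₑ ^ p * w x ^ p) ≠ ∞ →
      ∫⁻ x, (∫⁻ y, ‖fracIntegrand α f x y‖ₑ) ^ q * w x ^ q ≤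
        C * ((∫⁻ x, ‖f x‖ₑ ^ p * w x ^ p) ^ (1 / p)) ^ q := by
  have hq : 0 < q := by linarith
  have hp0 : 0 < p := by linarith
  have hq1 : 1 ≤ q := by linarith
  set p' := p / (p - 1) with hp'
  have hconj : p.HolderConjugate p' := Real.HolderConjugate.conjExponent hp
  have hp'0 : 0 < p' := hconj.symm.pos
  set D : ℝ≥0∞ := (2 * K) ^ p' + (2 * K) ^ q with hD
  have h2K : 2 * K ≠ ∞ := ENNReal.mul_ne_top (by simp) hK'
  have hDt : D ≠ ∞ := ENNReal.add_ne_top.2 ⟨ENNReal.rpow_ne_top_of_nonneg hp'0.le h2K,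
      ENNReal.rpow_ne_top_of_nonneg hq.le h2K⟩
  have hδ : 1 - D⁻¹ < 1 := ENNReal.sub_lt_self (by simp) one_ne_zero (ENNReal.inv_ne_zero.2 hDt)
  -- Any such `s` makes both geometric series converge: `s > 1` the one over levels, `s * (1 - D⁻¹)
  -- < 1` the one over `j`.
  obtain ⟨s, hs1, hs⟩ := exists_between (ENNReal.one_lt_inv.2 hδ)
  have hst : s ≠ ∞ := hs.ne_top
  have hsδ : s * (1 - D⁻¹) < 1 := by
    rcases eq_or_ne (1 - D⁻¹) 0 with h0 | h0
    · simp [h0]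
    · rw [ENNReal.lt_inv_iff_lt_inv, ← one_div s] at hs
      rw [mul_comm]
      exact ENNReal.mul_lt_of_lt_div hs
  set θ : ℝ≥0∞ := 2 ^ α with hθ
  set A : ℝ≥0∞ := (2 * 2 ^ n * (1 - θ⁻¹)⁻¹) ^ q * ((1 - (s ^ (1 / q))⁻¹)⁻¹) ^ q *
    ((1 - s * (1 - D⁻¹))⁻¹ * (K ^ q * D) * maximalConst p) with hA
  have hAt : A ≠ ∞ := by
    refine ENNReal.mul_ne_top (ENNReal.mul_ne_top (ENNReal.rpow_ne_top_of_nonneg hq.le ?_)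
      (ENNReal.rpow_ne_top_of_nonneg hq.le ?_)) (ENNReal.mul_ne_top (ENNReal.mul_ne_top ?_
      (ENNReal.mul_ne_top (ENNReal.rpow_ne_top_of_nonneg hq.le hK') hDt)) (maximalConst_ne_top hp))
    · exact ENNReal.mul_ne_top (ENNReal.mul_ne_top (by simp) (by simp))
        (one_sub_inv_inv_ne_top (ENNReal.one_lt_two_rpow hα₀))
    · exact one_sub_inv_inv_ne_top (ENNReal.one_lt_rpow hs1 (by positivity))
    · exact ENNReal.inv_ne_top.2 (tsub_pos_of_lt hsδ).ne'
  refine ⟨(6 ^ (n - α)) ^ q * ((Fintype.card (Fin n → Bool) : ℝ≥0∞) ^ (q - 1) *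
    (Fintype.card (Fin n → Bool) * A)), ?_, ?_⟩
  · refine ENNReal.mul_ne_top (ENNReal.rpow_ne_top_of_nonneg hq.le
      (ENNReal.rpow_ne_top_of_nonneg (by linarith) (by simp))) (ENNReal.mul_ne_top
      (ENNReal.rpow_ne_top_of_nonneg (by linarith) (by simp)) (ENNReal.mul_ne_top (by simp) hAt))
  intro w hw hw₀ hw' hK f hf hfin
  set N := (∫⁻ x, ‖f x‖ₑ ^ p * w x ^ p) ^ (1 / p) with hN
  have hNt : N ≠ ∞ := ENNReal.rpow_ne_top_of_nonneg (by positivity) hfin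
  set F : Measure (EuclideanSpace ℝ (Fin n)) := volume.withDensity fun x => ‖f x‖ₑ with hF
  set u : Measure (EuclideanSpace ℝ (Fin n)) := volume.withDensity fun x => w x ^ q with hu
  set σ : Measure (EuclideanSpace ℝ (Fin n)) := volume.withDensity fun x => w x ^ (-p') with hσ
  have hadm := fun t =>
    admissible_euclideanGrid hα₀ hp hpq hα hw hw₀ hw' hK hK' hf.enorm hNt t
  have hφ : Measurable fun x => ‖f x‖ₑ * w x ^ p' := hf.enorm.mul (hw.pow_const _)
  have hmax : ∀ t, ∫⁻ x, (euclideanGrid t).maxAvg F σ x ^ p ∂σ ≤ maximalConst p * N ^ p := by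
    intro t
    -- Relative to `σ` the function is `|f| * w ^ p'`, whose `L^p(σ)` norm is `N` because `p * p' -
    -- p' = p`.
    have e1 : F = σ.withDensity fun x => ‖f x‖ₑ * w x ^ p' := by
      rw [hσ, ← withDensity_mul _ (hw.pow_const _) hφ, hF]
      congr 1
      funext x
      have h0 : w x ^ p' ≠ 0 := (ENNReal.rpow_pos (hw₀ x).bot_lt (hw' x)).ne'
      have ht : w x ^ p' ≠ ∞ := ENNReal.rpow_ne_top_of_nonneg hp'0.le (hw' x)
      simp only [Pi.mul_apply]
      rw [ENNReal.rpow_neg, mul_left_comm, ENNReal.inv_mul_cancel h0 ht, mul_one]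
    have e2 : ∫⁻ x, (‖f x‖ₑ * w x ^ p') ^ p ∂σ = N ^ p := by
      rw [hσ, lintegral_withDensity_eq_lintegral_mul _ (hw.pow_const _)
        (hφ.pow_const _), hN, ← ENNReal.rpow_mul,
        one_div_mul_cancel hp0.ne', ENNReal.rpow_one]
      refine lintegral_congr fun x => ?_
      simp only [Pi.mul_apply]
      rw [ENNReal.mul_rpow_of_nonneg _ _ hp0.le, ← ENNReal.rpow_mul, mul_left_comm,
        ← ENNReal.rpow_add _ _ (hw₀ x) (hw' x)]
      congr 2
      have := hconj.mul_eq_add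
      linarith
    rw [e1, ← e2]
    exact (euclideanGrid t).lintegral_maxAvg_rpow_le σ (hadm t).σ_ne_zero (hadm t).σ_ne_top hφ hp
  have hfrac : ∀ t, ∫⁻ x, (euclideanGrid t).fracSum volume F θ x ^ q ∂u ≤ A * N ^ q := by
    intro t
    refine ((hadm t).lintegral_fracSum_rpow_le hs1 hst).trans ?_
    calc _ ≤ (2 * 2 ^ n * (1 - θ⁻¹)⁻¹) ^ q * ((1 - (s ^ (1 / q))⁻¹)⁻¹) ^ q *
        ((1 - s * (1 - D⁻¹))⁻¹ * (K ^ q * N ^ (q - p) * D) * (maximalConst p * N ^ p)) := by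
          gcongr; exact hmax t
      _ = A * (N ^ (q - p) * N ^ p) := by rw [hA]; ring
      _ = _ := by
          rw [← ENNReal.rpow_add_of_nonneg _ _ (by linarith) hp0.le, sub_add_cancel]
  have hms : ∀ t, Measurable ((euclideanGrid t).fracSum volume F θ) := fun t =>
    (euclideanGrid t).measurable_fracSum volume F θ
  calc ∫⁻ x, (∫⁻ y, ‖fracIntegrand α f x y‖ₑ) ^ q * w x ^ q
      ≤ ∫⁻ x, w x ^ q * ((6 ^ (n - α)) ^ q * ((Fintype.card (Fin n → Bool) : ℝ≥0∞) ^ (q - 1) *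
          ∑ t, (euclideanGrid t).fracSum volume F θ x ^ q)) := by
        refine lintegral_mono fun x => ?_
        simp only
        rw [mul_comm]
        gcongr
        calc (∫⁻ y, ‖fracIntegrand α f x y‖ₑ) ^ q
            ≤ (6 ^ (n - α) * ∑ t, (euclideanGrid t).fracSum volume F θ x) ^ q := by
              gcongr
              exact lintegral_enorm_fracIntegrand_le hαn hf x
          _ ≤ _ := by
              rw [ENNReal.mul_rpow_of_nonneg _ _ hq.le]
              gcongr
              exact ENNReal.rpow_sum_le_const_mul_sum_rpow _ _ hq1
    _ = (6 ^ (n - α)) ^ q * ((Fintype.card (Fin n → Bool) : ℝ≥0∞) ^ (q - 1) *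
          ∑ t, ∫⁻ x, (euclideanGrid t).fracSum volume F θ x ^ q ∂u) := by
        have hsm : Measurable fun x => ∑ t, (euclideanGrid t).fracSum volume F θ x ^ q :=
          Finset.measurable_fun_sum _ fun t _ => (hms t).pow_const q
        rw [← lintegral_finsetSum _ fun t _ => (hms t).pow_const q,
          ← lintegral_const_mul _ hsm, ← lintegral_const_mul _ (hsm.const_mul _), hu,
          lintegral_withDensity_eq_lintegral_mul _ (hw.pow_const _)
            ((hsm.const_mul _).const_mul _)]
        rfl
    _ ≤ (6 ^ (n - α)) ^ q * ((Fintype.card (Fin n → Bool) : ℝ≥0∞) ^ (q - 1) *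
          ∑ _t : Fin n → Bool, A * N ^ q) := by
        gcongr with t; exact hfrac t
    _ = _ := by
        rw [Finset.sum_const, Finset.card_univ, nsmul_eq_mul]
        ring

/-! ### Changing weights on null sets -/

section Congr

variable {n : ℕ} {α p q r : ℝ} {w w' : EuclideanSpace ℝ (Fin n) → ℝ≥0∞}

lemma apqConst_congr (h : w =ᵐ[volume] w') : apqConst p q w = apqConst p q w' := by
  unfold apqConst
  have : ∀ (a : EuclideanSpace ℝ (Fin n)) (l s : ℝ),
      ⨍⁻ x in cube a l, w x ^ s ∂volume = ⨍⁻ x in cube a l, w' x ^ s ∂volume := fun a l s =>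
    laverage_congr ((ae_restrict_of_ae h).mono fun x hx => by simp only [hx])
  simp only [this]

lemma weightedNorm_congr (h : w =ᵐ[volume] w') (f : EuclideanSpace ℝ (Fin n) → ℝ) :
    weightedNorm r w f = weightedNorm r w' f := by
  unfold weightedNorm
  rw [lintegral_congr_ae (g := fun x => ‖f x‖ₑ ^ r * w' x ^ r)
    (h.mono fun x hx => by simp only [hx])]

lemma fracIntegralBound_congr (h : w =ᵐ[volume] w') (C : ℝ≥0) :
    FracIntegralBound α p q w C ↔ FracIntegralBound α p q w' C := by
  simp only [FracIntegralBound, MemWeightedLp, weightedNorm_congr h]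

/-- Cancellations such as `w * w⁻¹ = 1` in `ℝ≥0∞` need a weight avoiding `0` and `∞` everywhere. All
notions involved ignore null sets, so the replacement value `1` is arbitrary. -/
lemma exists_measurable_pos_finite_ae_eq (hw : AEMeasurable w volume)
    (h : ∀ᵐ x ∂volume, 0 < w x ∧ w x < ∞) :
    ∃ w', Measurable w' ∧ (∀ x, w' x ≠ 0) ∧ (∀ x, w' x ≠ ∞) ∧ w =ᵐ[volume] w' := by
  classical
  refine ⟨fun x => if hw.mk w x = 0 ∨ hw.mk w x = ∞ then 1 else hw.mk w x,
    Measurable.ite ?_ measurable_const hw.measurable_mk, fun x => ?_, fun x => ?_, ?_⟩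
  · exact (hw.measurable_mk (measurableSet_singleton 0)).union
      (hw.measurable_mk (measurableSet_singleton ∞))
  · simp only; split_ifs with hx
    · exact one_ne_zero
    · exact fun h0 => hx (.inl h0)
  · simp only; split_ifs with hx
    · exact ENNReal.one_ne_top
    · exact fun h0 => hx (.inr h0)
  · filter_upwards [hw.ae_eq_mk, h] with x hx hx'
    rw [← hx, if_neg]
    exact not_or.2 ⟨hx'.1.ne', hx'.2.ne⟩

end Congr

/-! ### Measurability of the kernel. -/

section Kernel

variable {n : ℕ} {α : ℝ}

lemma fracIntegrand_congr {f g : EuclideanSpace ℝ (Fin n) → ℝ} (h : f =ᵐ[volume] g)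
    (x : EuclideanSpace ℝ (Fin n)) : fracIntegrand α f x =ᵐ[volume] fracIntegrand α g x :=
  h.mono fun y hy => by simp only [fracIntegrand, hy]

lemma measurable_uncurry_fracIntegrand {f : EuclideanSpace ℝ (Fin n) → ℝ} (hf : Measurable f) :
    Measurable (Function.uncurry (fracIntegrand α f)) := by
  have h1 : Measurable fun z : EuclideanSpace ℝ (Fin n) × EuclideanSpace ℝ (Fin n) =>
      ‖z.1 - z.2‖ := by fun_prop
  exact (hf.comp measurable_snd).div (h1.pow_const _)

end Kernel

/-! ### Sufficiency of the `A_{p,q}` condition -/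

/-- The constant is chosen before the weight; this uniformity yields the quantitative part of the
main theorem. -/
theorem exists_fracIntegralBound_of_apqConst_le {n : ℕ} {α p q : ℝ} (hα₀ : 0 < α) (hαn : α < n)
    (hp : 1 < p) (hpq : p < q) (hα : 1 / p - 1 / q = α / n) (K : ℝ≥0) :
    ∃ C : ℝ≥0, ∀ w : EuclideanSpace ℝ (Fin n) → ℝ≥0∞, AEMeasurable w volume → IsApq p q w →
      apqConst p q w ≤ K → FracIntegralBound α p q w C := by
  have hq : 0 < q := by linarith
  have hp0 : 0 < p := by linarith
  obtain ⟨C, hC, h⟩ := exists_lintegral_fracIntegrand_le hα₀ hαn hp hpq hα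
    (K := (K : ℝ≥0∞)) ENNReal.coe_ne_top
  refine ⟨(C ^ (1 / q)).toNNReal, fun w hw hA hK => ?_⟩
  obtain ⟨w', hw', hw'₀, hw't, hww'⟩ := exists_measurable_pos_finite_ae_eq hw hA.1
  rw [apqConst_congr hww'] at hK
  rw [fracIntegralBound_congr hww']
  clear hw hA hww'
  rintro f ⟨hf, hfN⟩
  set g := hf.aemeasurable.mk f with hg
  have hgm : Measurable g := hf.aemeasurable.measurable_mk
  have hfg : f =ᵐ[volume] g := hf.aemeasurable.ae_eq_mk
  set I := ∫⁻ x, ‖g x‖ₑ ^ p * w' x ^ p with hI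
  have hfI : weightedNorm p w' f = I ^ (1 / p) := by
    rw [weightedNorm, hI, lintegral_congr_ae (g := fun x => ‖g x‖ₑ ^ p * w' x ^ p)
      (hfg.mono fun x hx => by simp only [hx])]
  rw [hfI] at hfN
  have hIt : I ≠ ∞ := by
    rintro hI
    rw [hI, ENNReal.top_rpow_of_pos (by positivity)] at hfN
    exact hfN.ne rfl
  have key := h w' hw' hw'₀ hw't hK g hgm hIt
  set J : EuclideanSpace ℝ (Fin n) → ℝ≥0∞ := fun x => ∫⁻ y, ‖fracIntegrand α g x y‖ₑ with hJ
  have hunc := measurable_uncurry_fracIntegrand (α := α) hgm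
  have hJm : Measurable J := hunc.enorm.lintegral_prod_right'
  have hfin : C * (I ^ (1 / p)) ^ q ≠ ∞ :=
    ENNReal.mul_ne_top hC (ENNReal.rpow_ne_top_of_nonneg hq.le hfN.ne)
  -- Absolute convergence comes from the norm bound for `|f|` itself, since the weight vanishes
  -- nowhere.
  have hJt : ∀ᵐ x, J x < ∞ := by
    filter_upwards [ae_lt_top ((hJm.pow_const q).mul (hw'.pow_const q))
      (ne_top_of_le_ne_top hfin key)] with x hx
    rw [lt_top_iff_ne_top]
    intro hJx
    have hwq : w' x ^ q ≠ 0 := (ENNReal.rpow_pos (hw'₀ x).bot_lt (hw't x)).ne'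
    rw [Pi.mul_apply, hJx, ENNReal.top_rpow_of_pos hq, ENNReal.top_mul hwq] at hx
    exact hx.ne rfl
  have hIeq : fracIntegral α f = fracIntegral α g :=
    funext fun x => integral_congr_ae (fracIntegrand_congr hfg x)
  have hle : weightedNorm q w' (fracIntegral α f) ≤ C ^ (1 / q) * I ^ (1 / p) := by
    rw [hIeq, weightedNorm]
    calc (∫⁻ x, ‖fracIntegral α g x‖ₑ ^ q * w' x ^ q) ^ (1 / q)
        ≤ (C * (I ^ (1 / p)) ^ q) ^ (1 / q) := by
          gcongr
          refine le_trans (lintegral_mono fun x => ?_) key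
          gcongr
          exact enorm_integral_le_lintegral_enorm _
      _ = _ := by
          rw [ENNReal.mul_rpow_of_nonneg _ _ (by positivity), ← ENNReal.rpow_mul,
            mul_one_div_cancel hq.ne', ENNReal.rpow_one]
  have hCt : C ^ (1 / q) ≠ ∞ := ENNReal.rpow_ne_top_of_nonneg (by positivity) hC
  refine ⟨?_, ⟨?_, hle.trans_lt (ENNReal.mul_lt_top hCt.lt_top hfN)⟩, ?_⟩
  · filter_upwards [hJt] with x hx
    rw [integrable_congr (fracIntegrand_congr hfg x)]
    exact ⟨(hunc.comp measurable_prodMk_left).aestronglyMeasurable, hx⟩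
  · rw [hIeq]
    exact (hunc.stronglyMeasurable.integral_prod_right').aestronglyMeasurable
  · rw [hfI, ENNReal.coe_toNNReal hCt]
    exact hle

/-! ### Necessity of the `A_{p,q}` condition -/

section Necessity

variable {n : ℕ} {α p q : ℝ} {w : EuclideanSpace ℝ (Fin n) → ℝ≥0∞} {C : ℝ≥0}

/-- Testing the weighted inequality on a function supported in a bounded set `S`. -/
lemma FracIntegralBound.lintegral_mul_le (h : FracIntegralBound α p q w C) (hα₀ : 0 < α)
    (hαn : α < n) (hq : 0 < q) (hw : Measurable w) {S : Set (EuclideanSpace ℝ (Fin n))}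
    (hS : MeasurableSet S) {d : ℝ} (hd : ∀ x ∈ S, ∀ y ∈ S, ‖x - y‖ ≤ d)
    {f : EuclideanSpace ℝ (Fin n) → ℝ} (hf₀ : ∀ y, 0 ≤ f y) (hfS : ∀ y ∉ S, f y = 0)
    (hf : MemWeightedLp p w f) :
    (∫⁻ y, ‖f y‖ₑ) * (∫⁻ x in S, w x ^ q) ^ (1 / q) ≤
      ENNReal.ofReal (d ^ (n - α)) * (C * weightedNorm p w f) := by
  have hb : 0 < n - α := by linarith
  have hn : 0 < n := by exact_mod_cast hα₀.trans hαn
  -- In positive dimension points are null, so the singularity `y = x`, where the kernel takes the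
  -- value zero, can be discarded.
  have : Nontrivial (EuclideanSpace ℝ (Fin n)) :=
    Module.nontrivial_of_finrank_pos (R := ℝ) (by simpa using hn)
  obtain ⟨h1, -, h2⟩ := h f hf
  set D := ENNReal.ofReal (d ^ (n - α)) with hD
  set A := ∫⁻ y, ‖f y‖ₑ with hA
  have hpt : ∀ᵐ x, x ∈ S → A ≤ D * ‖fracIntegral α f x‖ₑ := by
    filter_upwards [h1] with x hx hxS
    have e1 : ‖fracIntegral α f x‖ₑ = ∫⁻ y, ‖fracIntegrand α f x y‖ₑ := by
      have h0 : ∀ y, 0 ≤ fracIntegrand α f x y := fun y =>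
        div_nonneg (hf₀ y) (by positivity)
      rw [← ofReal_integral_norm_eq_lintegral_enorm hx, fracIntegral,
        Real.enorm_of_nonneg (integral_nonneg h0)]
      congr 1
      exact integral_congr_ae (Filter.Eventually.of_forall fun y =>
        (Real.norm_of_nonneg (h0 y)).symm)
    rw [e1, ← lintegral_const_mul' _ _ ENNReal.ofReal_ne_top]
    refine lintegral_mono_ae ?_
    have hae : ∀ᵐ y, y ≠ x := compl_mem_ae_iff.2 (measure_singleton x)
    filter_upwards [hae] with y hy
    by_cases hyS : y ∈ S
    · have h0 : 0 < ‖x - y‖ := norm_pos_iff.2 (sub_ne_zero.2 hy.symm)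
      have h3 : 0 < ‖x - y‖ ^ (n - α) := by positivity
      have h4 : ‖x - y‖ ^ (n - α) ≤ d ^ (n - α) := by
        gcongr; exact hd x hxS y hyS
      rw [Real.enorm_of_nonneg (hf₀ y), fracIntegrand,
        Real.enorm_of_nonneg (div_nonneg (hf₀ y) h3.le),
        ← ENNReal.ofReal_mul (h3.le.trans h4)]
      refine ENNReal.ofReal_le_ofReal ?_
      rw [← mul_div_assoc, le_div_iff₀ h3, mul_comm]
      exact mul_le_mul_of_nonneg_right h4 (hf₀ y)
    · simp [hfS y hyS]
  calc A * (∫⁻ x in S, w x ^ q) ^ (1 / q)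
      = (∫⁻ x in S, A ^ q * w x ^ q) ^ (1 / q) := by
        rw [lintegral_const_mul _ (hw.pow_const q), ENNReal.mul_rpow_of_nonneg _ _ (by positivity),
          ← ENNReal.rpow_mul, mul_one_div_cancel hq.ne', ENNReal.rpow_one]
    _ ≤ (∫⁻ x in S, D ^ q * (‖fracIntegral α f x‖ₑ ^ q * w x ^ q)) ^ (1 / q) := by
        gcongr ?_ ^ (1 / q)
        refine lintegral_mono_ae ((ae_restrict_iff' hS).2 ?_)
        filter_upwards [hpt] with x hx hxS
        rw [← mul_assoc, ← ENNReal.mul_rpow_of_nonneg D _ hq.le]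
        gcongr
        exact hx hxS
    _ = D * (∫⁻ x in S, ‖fracIntegral α f x‖ₑ ^ q * w x ^ q) ^ (1 / q) := by
        rw [lintegral_const_mul' _ _ (ENNReal.rpow_ne_top_of_nonneg hq.le ENNReal.ofReal_ne_top),
          ENNReal.mul_rpow_of_nonneg _ _ (by positivity),
          ← ENNReal.rpow_mul, mul_one_div_cancel hq.ne', ENNReal.rpow_one]
    _ ≤ D * weightedNorm q w (fracIntegral α f) := by
        rw [weightedNorm]
        gcongr
        exact Measure.restrict_le_self
    _ ≤ _ := by gcongr

/-- Testing the weighted inequality on the indicator function of a set. -/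
lemma FracIntegralBound.measure_mul_le (h : FracIntegralBound α p q w C) (hα₀ : 0 < α)
    (hαn : α < n) (hp : 0 < p) (hq : 0 < q) (hw : Measurable w)
    {S E : Set (EuclideanSpace ℝ (Fin n))} (hS : MeasurableSet S) (hE : MeasurableSet E)
    (hES : E ⊆ S) {d : ℝ} (hd : ∀ x ∈ S, ∀ y ∈ S, ‖x - y‖ ≤ d)
    (hfin : ∫⁻ x in E, w x ^ p ≠ ∞) :
    volume E * (∫⁻ x in S, w x ^ q) ^ (1 / q) ≤
      ENNReal.ofReal (d ^ (n - α)) * (C * (∫⁻ x in E, w x ^ p) ^ (1 / p)) := by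
  set f : EuclideanSpace ℝ (Fin n) → ℝ := E.indicator 1 with hf
  have hfe : ∀ x, ‖f x‖ₑ = E.indicator 1 x := by
    intro x
    by_cases hx : x ∈ E <;> simp [hf, hx]
  have e1 : weightedNorm p w f = (∫⁻ x in E, w x ^ p) ^ (1 / p) := by
    rw [weightedNorm, ← lintegral_indicator hE]
    congr 2
    funext x
    rw [hfe]
    by_cases hx : x ∈ E <;> simp [hx, hp]
  have e2 : ∫⁻ y, ‖f y‖ₑ = volume E := by
    simp_rw [hfe]
    exact lintegral_indicator_one hE
  have := h.lintegral_mul_le hα₀ hαn hq hw hS hd (f := f)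
    (fun y => Set.indicator_nonneg (fun _ _ => zero_le_one) y)
    (fun y hy => Set.indicator_of_notMem (fun hyE => hy (hES hyE)) _)
    ⟨(measurable_one.indicator hE).aestronglyMeasurable, by
      rw [e1]; exact ENNReal.rpow_lt_top_of_nonneg (by positivity) hfin⟩
  rwa [e1, e2] at this

lemma norm_sub_le_of_mem_ball {R : ℝ} {x y : EuclideanSpace ℝ (Fin n)}
    (hx : x ∈ Metric.ball (0 : EuclideanSpace ℝ (Fin n)) R)
    (hy : y ∈ Metric.ball (0 : EuclideanSpace ℝ (Fin n)) R) : ‖x - y‖ ≤ 2 * R := by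
  rw [mem_ball_zero_iff] at hx hy
  linarith [norm_sub_le x y]

lemma ae_of_forall_ae_ball {P : EuclideanSpace ℝ (Fin n) → Prop} {N : ℕ}
    (h : ∀ M : ℕ, N ≤ M → ∀ᵐ x, x ∈ Metric.ball (0 : EuclideanSpace ℝ (Fin n)) M → P x) :
    ∀ᵐ x, P x := by
  have : ∀ᵐ x, ∀ M : ℕ, N ≤ M → x ∈ Metric.ball (0 : EuclideanSpace ℝ (Fin n)) M → P x := by
    rw [ae_all_iff]
    intro M
    by_cases hM : N ≤ M
    · exact (h M hM).mono fun x hx _ => hx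
    · exact Filter.Eventually.of_forall fun x hx => absurd hx hM
  filter_upwards [this] with x hx
  obtain ⟨M, hM⟩ := exists_nat_gt ‖x‖
  refine hx (max N M) (le_max_left _ _) ?_
  rw [mem_ball_zero_iff]
  exact hM.trans_le (by exact_mod_cast le_max_right N M)

/-- Some bounded set `E` of positive measure has `w` bounded on it. Testing on its indicator makes
`∫ w ^ q` finite over every large ball. -/
lemma FracIntegralBound.ae_lt_top (h : FracIntegralBound α p q w C) (hα₀ : 0 < α)
    (hαn : α < n) (hp : 0 < p) (hq : 0 < q) (hw : Measurable w)
    (hpos : 0 < volume {x | w x < ∞}) : ∀ᵐ x, w x < ∞ := by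
  obtain ⟨N, hN⟩ : ∃ N : ℕ, 0 < volume ({x | w x ≤ N} ∩
      Metric.ball (0 : EuclideanSpace ℝ (Fin n)) N) := by
    refine exists_measure_pos_of_not_measure_iUnion_null ?_
    have : {x | w x < ∞} ⊆ ⋃ N : ℕ, {x | w x ≤ N} ∩
        Metric.ball (0 : EuclideanSpace ℝ (Fin n)) N := by
      intro x hx
      obtain ⟨M, hM⟩ := ENNReal.exists_nat_gt (ne_of_lt hx)
      obtain ⟨M', hM'⟩ := exists_nat_gt ‖x‖
      refine Set.mem_iUnion.2 ⟨max M M', ?_, ?_⟩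
      · exact hM.le.trans (by exact_mod_cast le_max_left M M')
      · rw [mem_ball_zero_iff]
        exact hM'.trans_le (by exact_mod_cast le_max_right M M')
    exact (hpos.trans_le (measure_mono this)).ne'
  set E := {x | w x ≤ N} ∩ Metric.ball (0 : EuclideanSpace ℝ (Fin n)) N with hE
  have hEm : MeasurableSet E :=
    (measurableSet_le hw measurable_const).inter measurableSet_ball
  have hEt : volume E < ∞ := (measure_mono Set.inter_subset_right).trans_lt measure_ball_lt_top
  have hEI : ∫⁻ x in E, w x ^ p ≠ ∞ := by
    refine ne_top_of_le_ne_top (b := (N : ℝ≥0∞) ^ p * volume E)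
      (ENNReal.mul_ne_top (ENNReal.rpow_ne_top_of_nonneg hp.le (by simp)) hEt.ne) ?_
    rw [← setLIntegral_const]
    refine setLIntegral_mono' hEm fun x hx => ?_
    gcongr
    exact hx.1
  refine ae_of_forall_ae_ball (N := N) fun M hM => ?_
  have key := h.measure_mul_le hα₀ hαn hp hq hw (measurableSet_ball) hEm
    (Set.inter_subset_right.trans (Metric.ball_subset_ball (by exact_mod_cast hM)))
    (fun x hx y hy => norm_sub_le_of_mem_ball hx hy) hEI (S := Metric.ball 0 (M : ℝ))
  have hfin : ∫⁻ x in Metric.ball 0 (M : ℝ), w x ^ q ≠ ∞ := by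
    intro htop
    rw [htop, ENNReal.top_rpow_of_pos (by positivity), ENNReal.mul_top hN.ne', top_le_iff] at key
    exact ENNReal.mul_ne_top ENNReal.ofReal_ne_top (ENNReal.mul_ne_top ENNReal.coe_ne_top
      (ENNReal.rpow_ne_top_of_nonneg (by positivity) hEI)) key
  have := MeasureTheory.ae_lt_top (hw.pow_const q) hfin
  rw [ae_restrict_iff' measurableSet_ball] at this
  filter_upwards [this] with x hx hxM
  exact (ENNReal.rpow_lt_top_iff_of_pos hq).1 (hx hxM)

/-- If `w` vanished on a bounded set of positive measure, its indicator would have norm zero,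
forcing `∫ w ^ q = 0` over every large ball and hence `w = 0` almost everywhere. -/
lemma FracIntegralBound.ae_pos (h : FracIntegralBound α p q w C) (hα₀ : 0 < α)
    (hαn : α < n) (hp : 0 < p) (hq : 0 < q) (hw : Measurable w)
    (hpos : 0 < volume {x | 0 < w x}) : ∀ᵐ x, 0 < w x := by
  by_contra hnot
  rw [ae_iff] at hnot
  obtain ⟨N, hN⟩ : ∃ N : ℕ, 0 < volume ({x | ¬ 0 < w x} ∩
      Metric.ball (0 : EuclideanSpace ℝ (Fin n)) N) := by
    refine exists_measure_pos_of_not_measure_iUnion_null ?_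
    have : {x | ¬ 0 < w x} ⊆ ⋃ N : ℕ, {x | ¬ 0 < w x} ∩
        Metric.ball (0 : EuclideanSpace ℝ (Fin n)) N := by
      intro x hx
      obtain ⟨M', hM'⟩ := exists_nat_gt ‖x‖
      exact Set.mem_iUnion.2 ⟨M', hx, by rwa [mem_ball_zero_iff]⟩
    exact ((pos_iff_ne_zero.2 hnot).trans_le (measure_mono this)).ne'
  set E := {x | ¬ 0 < w x} ∩ Metric.ball (0 : EuclideanSpace ℝ (Fin n)) N with hE
  have hEm : MeasurableSet E :=
    (measurableSet_lt measurable_const hw).compl.inter measurableSet_ball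
  have hEI : ∫⁻ x in E, w x ^ p = 0 := by
    rw [setLIntegral_congr_fun (g := fun _ => 0) hEm fun x hx => ?_]
    · simp
    · have : w x = 0 := by simpa using hx.1
      simp [this, hp]
  refine hpos.ne' ?_
  have : ∀ᵐ x, ¬ 0 < w x := by
    refine ae_of_forall_ae_ball (N := N) fun M hM => ?_
    have key := h.measure_mul_le hα₀ hαn hp hq hw (measurableSet_ball) hEm
      (Set.inter_subset_right.trans (Metric.ball_subset_ball (by exact_mod_cast hM)))
      (fun x hx y hy => norm_sub_le_of_mem_ball hx hy) (hEI.trans_ne ENNReal.zero_ne_top)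
      (S := Metric.ball 0 (M : ℝ))
    rw [hEI, ENNReal.zero_rpow_of_pos (by positivity), mul_zero, mul_zero, nonpos_iff_eq_zero,
      mul_eq_zero, ENNReal.rpow_eq_zero_iff_of_pos (by positivity)] at key
    have h0 := key.resolve_left hN.ne'
    rw [lintegral_eq_zero_iff (hw.pow_const q)] at h0
    have h1 := (ae_restrict_iff' measurableSet_ball).1 h0
    filter_upwards [h1] with x hx hxM
    have := hx hxM
    simp only [Pi.zero_apply, ENNReal.rpow_eq_zero_iff_of_pos hq] at this
    simp [this]
  simpa only [ae_iff, not_not] using this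

lemma norm_sub_le_of_mem_cube {a : EuclideanSpace ℝ (Fin n)} {l : ℝ} (hl : 0 ≤ l)
    {x y : EuclideanSpace ℝ (Fin n)} (hx : x ∈ cube a l) (hy : y ∈ cube a l) :
    ‖x - y‖ ≤ √n * l := by
  rw [EuclideanSpace.norm_eq]
  refine Real.sqrt_le_iff.2 ⟨by positivity, ?_⟩
  rw [mul_pow, Real.sq_sqrt (by positivity)]
  calc ∑ i, ‖(x - y) i‖ ^ 2 ≤ ∑ _i : Fin n, l ^ 2 := by
        refine Finset.sum_le_sum fun i _ => ?_
        gcongr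
        rw [Real.norm_eq_abs, PiLp.sub_apply, abs_le]
        constructor <;> linarith [(hx i).1, (hx i).2, (hy i).1, (hy i).2]
    _ = _ := by simp

/-- Testing the weighted inequality on truncations of `w ^ (-p')`. -/
lemma FracIntegralBound.lintegral_mul_lintegral_le (h : FracIntegralBound α p q w C)
    (hα₀ : 0 < α) (hαn : α < n) (hp : 1 < p) (hq : 0 < q) (hw : Measurable w)
    (hw₀ : ∀ x, w x ≠ 0) (hw' : ∀ x, w x ≠ ∞) {S : Set (EuclideanSpace ℝ (Fin n))}
    (hS : MeasurableSet S) (hSt : volume S ≠ ∞) {d : ℝ} (hd : ∀ x ∈ S, ∀ y ∈ S, ‖x - y‖ ≤ d) :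
    (∫⁻ x in S, w x ^ q) ^ (1 / q) *
        (∫⁻ x in S, w x ^ (-(p / (p - 1)))) ^ (1 / (p / (p - 1))) ≤
      ENNReal.ofReal (d ^ (n - α)) * C := by
  set p' := p / (p - 1) with hp'
  have hconj : p.HolderConjugate p' := Real.HolderConjugate.conjExponent hp
  have hp'0 : 0 < p' := hconj.symm.pos
  have hp0 : 0 < p := hconj.pos
  set ν := (volume.restrict S).withDensity fun x => w x ^ (-p') with hν
  set X := (∫⁻ x in S, w x ^ q) ^ (1 / q) with hX
  set B := ENNReal.ofReal (d ^ (n - α)) * C with hB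
  have hBt : B ≠ ∞ := ENNReal.mul_ne_top ENNReal.ofReal_ne_top ENNReal.coe_ne_top
  -- Truncation makes the test function admissible and its norm finite, so that a power of it can be
  -- cancelled. Monotone convergence removes it.
  set T : ℕ → Set (EuclideanSpace ℝ (Fin n)) := fun k => {x | w x ^ (-p') ≤ k} with hT
  have hwm : Measurable fun x => w x ^ (-p') := hw.pow_const _
  have hTm : ∀ k, MeasurableSet (T k) := fun k => measurableSet_le hwm measurable_const
  have key : ∀ k, ν (T k) ^ (1 / p') * X ≤ B := by
    intro k
    set E := T k ∩ S with hE
    have hEm : MeasurableSet E := (hTm k).inter hS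
    have hνT : ν (T k) = ∫⁻ x in E, w x ^ (-p') := by
      rw [hν, withDensity_apply _ (hTm k), Measure.restrict_restrict (hTm k)]
    have hfin : ν (T k) ≠ ∞ := by
      rw [hνT]
      refine ne_top_of_le_ne_top (b := (k : ℝ≥0∞) * volume E)
        (ENNReal.mul_ne_top (by simp)
          (ne_top_of_le_ne_top hSt (measure_mono Set.inter_subset_right))) ?_
      rw [← setLIntegral_const]
      exact setLIntegral_mono' hEm fun x hx => hx.1
    rcases eq_or_ne (ν (T k)) 0 with h0 | h0
    · rw [h0, ENNReal.zero_rpow_of_pos (by positivity), zero_mul]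
      exact zero_le
    set f : EuclideanSpace ℝ (Fin n) → ℝ := E.indicator fun x => (w x ^ (-p')).toReal with hf
    have hfe : ∀ x, ‖f x‖ₑ = E.indicator (fun x => w x ^ (-p')) x := by
      intro x
      by_cases hx : x ∈ E
      · have : w x ^ (-p') ≠ ∞ := by
          rw [ENNReal.rpow_neg]
          exact ENNReal.inv_ne_top.2 (ENNReal.rpow_pos (hw₀ x).bot_lt (hw' x)).ne'
        simp only [hf, hx, Set.indicator_of_mem]
        rw [Real.enorm_of_nonneg ENNReal.toReal_nonneg, ENNReal.ofReal_toReal this]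
      · simp [hf, hx]
    have e1 : weightedNorm p w f = ν (T k) ^ (1 / p) := by
      rw [weightedNorm, hνT, ← lintegral_indicator hEm]
      congr 2
      funext x
      rw [hfe]
      by_cases hx : x ∈ E
      · simp only [hx, Set.indicator_of_mem]
        rw [← ENNReal.rpow_mul, ← ENNReal.rpow_add _ _ (hw₀ x) (hw' x)]
        congr 1
        have := hconj.mul_eq_add
        linarith
      · simp [hx, hp0]
    have e2 : ∫⁻ y, ‖f y‖ₑ = ν (T k) := by
      simp_rw [hfe]
      rw [lintegral_indicator hEm, hνT]
    have h1 := h.lintegral_mul_le hα₀ hαn hq hw hS hd (f := f)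
      (fun y => Set.indicator_nonneg (fun _ _ => ENNReal.toReal_nonneg) y)
      (fun y hy => Set.indicator_of_notMem (fun hyE => hy hyE.2) _)
      ⟨(hwm.ennreal_toReal.indicator hEm).aestronglyMeasurable, by
        rw [e1]; exact ENNReal.rpow_lt_top_of_nonneg (by positivity) hfin⟩
    rw [e1, e2] at h1
    have hs0 : ν (T k) ^ (1 / p) ≠ 0 := (ENNReal.rpow_pos h0.bot_lt hfin).ne'
    have hst : ν (T k) ^ (1 / p) ≠ ∞ := ENNReal.rpow_ne_top_of_nonneg (by positivity) hfin
    refine (ENNReal.mul_le_mul_iff_right hs0 hst).1 ?_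
    calc ν (T k) ^ (1 / p) * (ν (T k) ^ (1 / p') * X) = ν (T k) * X := by
          rw [← mul_assoc, ← ENNReal.rpow_add _ _ h0 hfin, one_div, one_div,
            hconj.inv_add_inv_eq_one, ENNReal.rpow_one]
      _ ≤ ENNReal.ofReal (d ^ (n - α)) * (C * ν (T k) ^ (1 / p)) := h1
      _ = _ := by rw [hB]; ring
  rcases eq_or_ne X 0 with hX0 | hX0
  · rw [hX0, zero_mul]; exact zero_le
  have hU : ⋃ k, T k = Set.univ := by
    refine Set.eq_univ_of_forall fun x => ?_
    have : w x ^ (-p') ≠ ∞ := by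
      rw [ENNReal.rpow_neg]
      exact ENNReal.inv_ne_top.2 (ENNReal.rpow_pos (hw₀ x).bot_lt (hw' x)).ne'
    obtain ⟨k, hk⟩ := ENNReal.exists_nat_gt this
    exact Set.mem_iUnion.2 ⟨k, hk.le⟩
  have hmono : Monotone T := fun k l hkl x (hx : w x ^ (-p') ≤ k) =>
    show w x ^ (-p') ≤ l from hx.trans (by exact_mod_cast hkl)
  have hνU : ∫⁻ x in S, w x ^ (-p') = ⨆ k, ν (T k) := by
    rw [← hmono.measure_iUnion, hU, hν, withDensity_apply _ .univ, setLIntegral_univ]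
  have hle : ∫⁻ x in S, w x ^ (-p') ≤ (B / X) ^ p' := by
    rw [hνU]
    refine iSup_le fun k => ?_
    have h1 : ν (T k) ^ (1 / p') ≤ B / X := by
      rw [ENNReal.le_div_iff_mul_le (.inl hX0) (.inr hBt)]
      exact key k
    have h2 := ENNReal.rpow_le_rpow h1 hp'0.le
    rwa [← ENNReal.rpow_mul, one_div_mul_cancel hp'0.ne', ENNReal.rpow_one] at h2
  have h3 : (∫⁻ x in S, w x ^ (-p')) ^ (1 / p') ≤ B / X := by
    have := ENNReal.rpow_le_rpow hle (one_div_nonneg.2 hp'0.le)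
    rwa [← ENNReal.rpow_mul, mul_one_div_cancel hp'0.ne', ENNReal.rpow_one] at this
  calc X * (∫⁻ x in S, w x ^ (-p')) ^ (1 / p') ≤ X * (B / X) := by gcongr
    _ ≤ B := ENNReal.mul_div_le

/-- The estimate is scale invariant: a cube of side `l` has diameter at most `√n * l`, and `|Q| ^
(1/q + 1/p') = l ^ (n - α)`. Thus the powers of `l` cancel and leave `√n ^ (n - α) * C`. -/
lemma FracIntegralBound.apqConst_lt_top (h : FracIntegralBound α p q w C)
    (hα₀ : 0 < α) (hαn : α < n) (hp : 1 < p) (hq : 0 < q) (hα : 1 / p - 1 / q = α / n)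
    (hw : Measurable w) (hw₀ : ∀ x, w x ≠ 0) (hw' : ∀ x, w x ≠ ∞) : apqConst p q w < ∞ := by
  set p' := p / (p - 1) with hp'
  have hconj : p.HolderConjugate p' := Real.HolderConjugate.conjExponent hp
  have hp'0 : 0 < p' := hconj.symm.pos
  have hn : (n : ℝ) ≠ 0 := (hα₀.trans hαn).ne'
  have hfin : ENNReal.ofReal (√n ^ (n - α)) * C < ∞ :=
    ENNReal.mul_lt_top ENNReal.ofReal_lt_top ENNReal.coe_lt_top
  refine lt_of_le_of_lt (iSup_le fun a => iSup_le fun l => iSup_le fun hl => ?_) hfin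
  have hv0 := volume_cube_ne_zero a hl
  have hvt := volume_cube_ne_top a l
  rw [setLAverage_eq, setLAverage_eq, ENNReal.div_rpow_of_nonneg _ _ (by positivity),
    ENNReal.div_rpow_of_nonneg _ _ (by positivity)]
  have key := h.lintegral_mul_lintegral_le hα₀ hαn hp hq hw hw₀ hw' (measurableSet_cube a l) hvt
    fun x hx y hy => norm_sub_le_of_mem_cube hl.le hx hy
  have hvol : volume (cube a l) ^ (1 / q) * volume (cube a l) ^ (1 / p') =
      ENNReal.ofReal (l ^ (n - α)) := by
    rw [← ENNReal.rpow_add _ _ hv0 hvt, volume_cube, ← ENNReal.rpow_natCast, ← ENNReal.rpow_mul,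
      ENNReal.ofReal_rpow_of_pos hl]
    congr 2
    have h1 := hconj.inv_add_inv_eq_one
    have h2 : 1 / q + 1 / p' = 1 - α / n := by
      rw [← hα]; simp only [one_div] at *; linarith
    rw [h2]; field_simp
  have hl0 : ENNReal.ofReal (l ^ (n - α)) ≠ 0 := by
    have : 0 < l ^ (n - α) := Real.rpow_pos_of_pos hl _
    simpa using this
  have c1 : volume (cube a l) ^ (1 / q) ≠ 0 := (ENNReal.rpow_pos hv0.bot_lt hvt).ne'
  have c2 : volume (cube a l) ^ (1 / q) ≠ ∞ := ENNReal.rpow_ne_top_of_nonneg (by positivity) hvt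
  rw [← ENNReal.mul_div_mul_comm (.inl c1) (.inl c2), hvol, ENNReal.div_le_iff hl0 ENNReal.ofReal_ne_top]
  refine key.trans_eq ?_
  rw [Real.mul_rpow (by positivity) hl.le, ENNReal.ofReal_mul (by positivity)]
  ring

theorem FracIntegralBound.isApq (h : FracIntegralBound α p q w C) (hw : IsWeight w)
    (hα₀ : 0 < α) (hαn : α < n) (hp : 1 < p) (hq : 0 < q) (hα : 1 / p - 1 / q = α / n) :
    IsApq p q w := by
  have hp0 : 0 < p := by linarith
  have hae := hw.aemeasurable.ae_eq_mk
  have hm := hw.aemeasurable.measurable_mk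
  have h1 := (fracIntegralBound_congr hae C).1 h
  have hpos : ∀ᵐ x, 0 < w x := by
    have := h1.ae_pos hα₀ hαn hp0 hq hm (by
      rw [← measure_congr (hae.mono fun x hx => ?_)]
      · exact hw.pos_on_pos_measure
      · exact congrArg (fun z : ℝ≥0∞ => 0 < z) hx)
    filter_upwards [this, hae] with x hx hx'
    rwa [hx']
  have hlt : ∀ᵐ x, w x < ∞ := by
    have := h1.ae_lt_top hα₀ hαn hp0 hq hm (by
      rw [← measure_congr (hae.mono fun x hx => ?_)]
      · exact hw.finite_on_pos_measure
      · exact congrArg (fun z : ℝ≥0∞ => z < ∞) hx)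
    filter_upwards [this, hae] with x hx hx'
    rwa [hx']
  have hboth : ∀ᵐ x, 0 < w x ∧ w x < ∞ := hpos.and hlt
  obtain ⟨w', hw', hw'₀, hw't, hww'⟩ := exists_measurable_pos_finite_ae_eq hw.aemeasurable hboth
  refine ⟨hboth, ?_⟩
  rw [apqConst_congr hww']
  exact ((fracIntegralBound_congr hww' C).1 h).apqConst_lt_top hα₀ hαn hp hq hα hw' hw'₀ hw't

end Necessity

/-! ### The equivalence and the dependence of the constant. -/

theorem mainTheorem3 (n : ℕ) (α p q : ℝ) (hα₀ : 0 < α) (hαn : α < n) (hp₁ : 1 < p)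
    (hpn : p < n / α) (hpq : 1 / p - 1 / q = α / n) :
    ∃ Φ : ℝ≥0 → ℝ≥0, ∀ w : EuclideanSpace ℝ (Fin n) → ℝ≥0∞, IsWeight w →
      (IsApq p q w ↔ ∃ C : ℝ≥0, FracIntegralBound α p q w C) ∧
      (IsApq p q w → FracIntegralBound α p q w (Φ (apqConst p q w).toNNReal)) := by
  have hp0 : 0 < p := by linarith
  have hn : (0 : ℝ) < n := hα₀.trans hαn
  -- Even the sign of `q` has to be derived: `p < n / α` makes `1 / q` positive.
  have hlt : p < q := by
    have h1 : α / n < 1 / p := by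
      rw [div_lt_div_iff₀ hn hp0, one_mul, mul_comm]
      exact (lt_div_iff₀ hα₀).1 hpn
    have h2 : 0 < α / n := by positivity
    have h3 : 0 < 1 / q := by linarith
    exact lt_of_one_div_lt_one_div (one_div_pos.1 h3) (by linarith)
  choose Φ hΦ using exists_fracIntegralBound_of_apqConst_le hα₀ hαn hp₁ hlt hpq
  have hsuff : ∀ w : EuclideanSpace ℝ (Fin n) → ℝ≥0∞, IsWeight w → IsApq p q w →
      FracIntegralBound α p q w (Φ (apqConst p q w).toNNReal) := fun w hw hA =>
    hΦ _ w hw.aemeasurable hA (ENNReal.coe_toNNReal hA.2.ne).symm.le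
  refine ⟨Φ, fun w hw => ⟨⟨fun hA => ⟨_, hsuff w hw hA⟩, ?_⟩, hsuff w hw⟩⟩
  rintro ⟨C, hC⟩
  exact hC.isApq hw hα₀ hαn hp₁ (hp0.trans hlt) hpq
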